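/- Let $k$ be a field and let $A$ and $B$ be finite-dimensional (associative, unital) $k$-algebras. For a ring $R\in\{A,B,A\otimes_kA^{\mathrm{op}},B\otimes_kB^{\mathrm{op}}\}$ and a finitely generated left $R$-module $X$, let $\Omega_R(X)$ be the kernel of a projective cover of $X$, and put $\Omega_R^0(X)=X$, $\Omega_R^{n+1}(X)=\Omega_R(\Omega_R^{n}(X))$. For an $R$-module $U$, let $\mathrm{add}(U)$ be the class of modules isomorphic to direct summands of finite direct sums of copies of $U$. For integers $m,n\ge 0$, the algebra $A$ is called an $(m,n)$-Igusa–Todorov algebra if there is a finitely generated left $A$-module $U$ such that for every finitely generated left $A$-module $X$ there is an exact sequence $$0\longrightarrow U_m\longrightarrow\cdots\longrightarrow U_1\longrightarrow U_0\longrightarrow\Omega_A^n(X)\longrightarrow 0$$ with $U_i\in\mathrm{add}(U)$ for $0\le i\le m$. The Igusa–Todorov distance of $A$ is $$\mathrm{IT.dist}(A)=\inf\{m\ge 0\mid A\text{ is an }(m,n)\text{-Igusa–Todorov algebra for some }n\ge 0\}\in\mathbb{N}\cup\{\infty\},$$ and likewise for $B$. Identify $A$-$A$-bimodules on which $k$ acts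 centrally with left modules over $A^e=A\otimes_kA^{\mathrm{op}}$, and similarly for $B$. The algebras $A$ and $B$ are called singularly equivalent of Morita type with level if there are an integer $l\ge 0$, an $A$-$B$-bimodule $M$ and a $B$-$A$-bimodule $N$ ($k$ acting centrally on both) such that 1. the one-sided modules ${}_AM$, $M_B$, ${}_BN$ and $N_A$ are all finitely generated and projective; 2. $M\otimes_BN\cong\Omega^l_{A^e}(A)$ in the stable category of finitely generated $A^e$-modules (homomorphisms modulo those factoring through projective modules), and $N\otimes_AM\cong\Omega^l_{B^e}(B)$ in the stable category of finitely generated $B^e$-modules. **Theorem.** If $A$ and $B$ are singularly equivalent of Morita type with level, then $\mathrm{IT.dist}(A)=\mathrm{IT.dist}(B)$. -/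

import Mathlib

open scoped TensorProduct

universe u

/-! ### Syzygies via projective covers -/

/-- `f : P → X` is a projective cover: `P` is projective, `f` is surjective, and the kernel of `f`
is a superfluous submodule of `P`. -/
def IsProjectiveCover {R : Type*} [Ring R] {P X : Type*} [AddCommGroup P] [Module R P]
    [AddCommGroup X] [Module R X] (f : P →ₗ[R] X) : Prop :=
  Module.Projective R P ∧ Function.Surjective f ∧
    ∀ L : Submodule R P, LinearMap.ker f ⊔ L = ⊤ → L = ⊤

/-- `IsSyzygy R X n Z`: the module `Z` is (isomorphic to) the `n`-th syzygy `Ωⁿ(X)`, where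
`Ω⁰(X) = X` and `Ωⁿ⁺¹(X) = Ω(Ωⁿ(X))` is the kernel of a projective cover of `Ωⁿ(X)`. -/
def IsSyzygy (R : Type u) [Ring R] (X : Type*) [AddCommGroup X] [Module R X] :
    ℕ → ModuleCat.{u} R → Prop
  | 0, Z => Nonempty (Z ≃ₗ[R] X)
  | n + 1, Z => ∃ K : ModuleCat.{u} R, IsSyzygy R X n K ∧
      ∃ (P : ModuleCat.{u} R) (f : P →ₗ[R] K),
        IsProjectiveCover f ∧ Nonempty (Z ≃ₗ[R] LinearMap.ker f)

/-! ### The Igusa-Todorov distance -/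

/-- `X ∈ add(U)`: the module `X` is isomorphic to a direct summand of a finite direct sum of copies
of `U`. -/
def InAdd (R : Type*) [Ring R] (U : Type*) [AddCommGroup U] [Module R U]
    (X : Type*) [AddCommGroup X] [Module R X] : Prop :=
  ∃ (r : ℕ) (i : X →ₗ[R] (Fin r → U)) (p : (Fin r → U) →ₗ[R] X), p ∘ₗ i = LinearMap.id

/-- There is an exact sequence `0 → U_m → ⋯ → U_1 → U_0 → Z → 0` with every `U_i` in `add(U)`.
The sequence is continued by zero modules to the left of `U_m`. -/
def HasAddResolution (R : Type u) [Ring R] (U : Type*) [AddCommGroup U] [Module R U] (m : ℕ)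
    (Z : Type*) [AddCommGroup Z] [Module R Z] : Prop :=
  ∃ (V : ℕ → ModuleCat.{u} R) (d : ∀ i, V (i + 1) →ₗ[R] V i) (ε : V 0 →ₗ[R] Z),
    (∀ i ≤ m, InAdd R U (V i)) ∧ (∀ i, m < i → Subsingleton (V i)) ∧
    Function.Surjective ε ∧ Function.Exact (d 0) ε ∧
    ∀ i, Function.Exact (d (i + 1)) (d i)

/-- `R` is an `(m,n)`-Igusa-Todorov algebra (all modules are finitely generated left modules). -/
def IsIgusaTodorov (R : Type u) [Ring R] (m n : ℕ) : Prop :=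
  ∃ U : ModuleCat.{u} R, Module.Finite R U ∧
    ∀ X : ModuleCat.{u} R, Module.Finite R X →
      ∃ Z : ModuleCat.{u} R, IsSyzygy R X n Z ∧ HasAddResolution R U m Z

/-- The Igusa-Todorov distance of `R`: the infimum in `ℕ ∪ {∞}` of all `m` such that `R` is an
`(m,n)`-Igusa-Todorov algebra for some `n`. -/
noncomputable def ITdist (R : Type u) [Ring R] : ℕ∞ :=
  ⨅ (m : ℕ) (_ : ∃ n : ℕ, IsIgusaTodorov R m n), (m : ℕ∞)

/-! ### The stable module category -/

/-- A homomorphism that factors through a finitely generated projective module, that is, one that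
is zero in the stable module category. -/
def FactorsThroughProjective (R : Type u) [Ring R] {X Y : Type*} [AddCommGroup X] [Module R X]
    [AddCommGroup Y] [Module R Y] (f : X →ₗ[R] Y) : Prop :=
  ∃ P : ModuleCat.{u} R, Module.Finite R P ∧ Module.Projective R P ∧
    ∃ (α : X →ₗ[R] P) (β : P →ₗ[R] Y), f = β ∘ₗ α

/-- `X` and `Y` are isomorphic in the stable module category: there are homomorphisms that are
mutually inverse modulo homomorphisms factoring through projective modules. -/
def StablyIsomorphic (R : Type u) [Ring R] (X Y : Type*) [AddCommGroup X] [Module R X]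
    [AddCommGroup Y] [Module R Y] : Prop :=
  ∃ (f : X →ₗ[R] Y) (g : Y →ₗ[R] X),
    FactorsThroughProjective R (g ∘ₗ f - LinearMap.id) ∧
    FactorsThroughProjective R (f ∘ₗ g - LinearMap.id)

/-! ### The tensor product of bimodules over a noncommutative algebra

An `A`-`B`-bimodule over `k` is a `k`-module `M` with commuting `k`-linear actions of `A` and of
`Bᵐᵒᵖ`; `A`-`C`-bimodules are identified with left `A ⊗[k] Cᵐᵒᵖ`-modules. -/

section BimoduleTensor

variable (k A B C M N : Type*) [Field k] [Ring A] [Algebra k A] [Ring B] [Algebra k B]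
  [Ring C] [Algebra k C]
  [AddCommGroup M] [Module k M] [Module A M] [Module Bᵐᵒᵖ M]
  [IsScalarTower k A M] [IsScalarTower k Bᵐᵒᵖ M] [SMulCommClass A Bᵐᵒᵖ M]
  [AddCommGroup N] [Module k N] [Module B N] [Module Cᵐᵒᵖ N]
  [IsScalarTower k B N] [IsScalarTower k Cᵐᵒᵖ N] [SMulCommClass B Cᵐᵒᵖ N]

/-- The `A`-`C`-bimodule structure on `M ⊗[k] N` given by `a • (m ⊗ n) • c = (a • m) ⊗ (n • c)`. -/
noncomputable abbrev outerModule : Module (A ⊗[k] Cᵐᵒᵖ) (M ⊗[k] N) :=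
  Module.compHom (M ⊗[k] N)
    (Module.endTensorEndAlgHom.comp
      (Algebra.TensorProduct.map (Algebra.lsmul k k M : A →ₐ[k] Module.End k M)
        (Algebra.lsmul k k N : Cᵐᵒᵖ →ₐ[k] Module.End k N))).toRingHom

attribute [local instance] outerModule

theorem outer_smul_tmul (a : A) (c : Cᵐᵒᵖ) (m : M) (n : N) :
    (a ⊗ₜ[k] c : A ⊗[k] Cᵐᵒᵖ) • (m ⊗ₜ[k] n) = (a • m) ⊗ₜ[k] (c • n) := rfl

/-- The relations `(m • b) ⊗ n = m ⊗ (b • n)`: the `k`-span of all their differences, which is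
stable under the outer bimodule structure. -/
noncomputable def balancedRelations : Submodule (A ⊗[k] Cᵐᵒᵖ) (M ⊗[k] N) where
  __ := Submodule.span k
    {t : M ⊗[k] N | ∃ (m : M) (b : B) (n : N),
      t = (MulOpposite.op b • m) ⊗ₜ[k] n - m ⊗ₜ[k] (b • n)}
  smul_mem' := by
    intro x t ht
    simp only [AddSubsemigroup.mem_carrier, AddSubmonoid.mem_toSubsemigroup,
      Submodule.mem_toAddSubmonoid] at ht ⊢
    induction x using TensorProduct.induction_on with
    | zero => exact (zero_smul (A ⊗[k] Cᵐᵒᵖ) t).symm ▸ zero_mem _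
    | add x y hx hy => rw [add_smul]; exact add_mem hx hy
    | tmul a c =>
      induction ht using Submodule.span_induction with
      | zero => rw [smul_zero]; exact zero_mem _
      | add s t _ _ hs ht => rw [smul_add]; exact add_mem hs ht
      | mem t ht =>
        obtain ⟨m, b, n, rfl⟩ := ht
        refine Submodule.subset_span ⟨a • m, b, c • n, ?_⟩
        rw [smul_sub, outer_smul_tmul, outer_smul_tmul, smul_comm a (MulOpposite.op b) m,
          smul_comm b c n]
      | smul r t _ ht =>
        have h : (a ⊗ₜ[k] c : A ⊗[k] Cᵐᵒᵖ) • (r • t) = r • ((a ⊗ₜ[k] c : A ⊗[k] Cᵐᵒᵖ) • t) :=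
          LinearMap.map_smul _ r t
        rw [h]
        exact Submodule.smul_mem _ r ht

/-- The tensor product `M ⊗_B N` of an `A`-`B`-bimodule `M` and a `B`-`C`-bimodule `N`, as an
`A`-`C`-bimodule: the quotient of `M ⊗[k] N` by the relations `(m • b) ⊗ n = m ⊗ (b • n)`. -/
abbrev BimoduleTensor : Type _ := (M ⊗[k] N) ⧸ balancedRelations k A B C M N

end BimoduleTensor

/-! ### Singular equivalences of Morita type with level -/

attribute [local instance] TensorProduct.Algebra.module in
/-- The `A`-`A`-bimodule `E`, viewed as a left module over the enveloping algebra
`Aᵉ = A ⊗[k] Aᵐᵒᵖ`, is stably isomorphic to the `l`-th syzygy of the regular bimodule `A`, on which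
`Aᵉ` acts by `(a ⊗ b) • x = a * x * b`. -/
def IsStablySyzygyOfRegular (k : Type*) (A : Type u) [Field k] [Ring A] [Algebra k A] (l : ℕ)
    (E : Type*) [AddCommGroup E] [Module (A ⊗[k] Aᵐᵒᵖ) E] : Prop :=
  ∃ Z : ModuleCat.{u} (A ⊗[k] Aᵐᵒᵖ),
    IsSyzygy (A ⊗[k] Aᵐᵒᵖ) A l Z ∧ StablyIsomorphic (A ⊗[k] Aᵐᵒᵖ) E Z

/-- The bimodules `M` (an `A`-`B`-bimodule) and `N` (a `B`-`A`-bimodule) define a singular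
equivalence of Morita type with level `l` between the `k`-algebras `A` and `B`. -/
structure IsSingularEquivOfMoritaTypeWithLevel (k A B M N : Type*) [Field k]
    [Ring A] [Algebra k A] [Ring B] [Algebra k B]
    [AddCommGroup M] [Module k M] [Module A M] [Module Bᵐᵒᵖ M]
    [IsScalarTower k A M] [IsScalarTower k Bᵐᵒᵖ M] [SMulCommClass A Bᵐᵒᵖ M]
    [AddCommGroup N] [Module k N] [Module B N] [Module Aᵐᵒᵖ N]
    [IsScalarTower k B N] [IsScalarTower k Aᵐᵒᵖ N] [SMulCommClass B Aᵐᵒᵖ N]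
    (l : ℕ) : Prop where
  finite_left_M : Module.Finite A M
  projective_left_M : Module.Projective A M
  finite_right_M : Module.Finite Bᵐᵒᵖ M
  projective_right_M : Module.Projective Bᵐᵒᵖ M
  finite_left_N : Module.Finite B N
  projective_left_N : Module.Projective B N
  finite_right_N : Module.Finite Aᵐᵒᵖ N
  projective_right_N : Module.Projective Aᵐᵒᵖ N
  /-- `M ⊗_B N` is isomorphic to the `l`-th syzygy of `A` in the stable category of
  `A`-`A`-bimodules. -/
  tensor_MN : IsStablySyzygyOfRegular k A l (BimoduleTensor k A B A M N)
  /-- `N ⊗_A M` is isomorphic to the `l`-th syzygy of `B` in the stable category of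
  `B`-`B`-bimodules. -/
  tensor_NM : IsStablySyzygyOfRegular k B l (BimoduleTensor k B A B N M)

-- The functors `M ⊗_B -` and `N ⊗_A -` carry an Igusa–Todorov module of `A` to one of `B`, with the
-- same `m` and with `n` replaced by `l + n`. Let `U` be such a module for `A`, let `Y` be a
-- finitely generated `B`-module and put `X = M ⊗_B Y`. Since `N` is right projective, `N ⊗_A -` is
-- exact, so a resolution of `Ωⁿ(X)` by `add(U)` becomes a resolution of `N ⊗_A Ωⁿ(X)` by `add(N ⊗_A
-- U)`, of the same length.
--
-- Since `N` is also left projective, `N ⊗_A -` preserves projectives. Hence, up to stable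
-- isomorphism, `N ⊗_A Ωⁿ(X)` is the `n`-th syzygy of `N ⊗_A M ⊗_B Y`
-- (`IsSyzygy.stableIso_balancedTensor`). That module is stably `Ωˡ(Y)`: the bimodule `N ⊗_A M` is
-- stably `Ωˡ(B)`, and `- ⊗_B Y` turns a projective presentation of a right projective bimodule into
-- one of left modules (`IsSyzygy.stableIso_tensor`). So `N ⊗_A Ωⁿ(X)` is stably isomorphic to
-- `Ωˡ⁺ⁿ(Y)`.
--
-- The stable isomorphism is removed by enlarging the module to `(N ⊗_A U) ⊕ B`
-- (`HasAddResolution.of_stableIso`), where only the last term of the resolution changes. The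
-- hypotheses are symmetric in `A` and `B`, which gives both inequalities. Stable isomorphisms are
-- handled through retracts of `Y ⊕ Rʳ`, so no Krull–Schmidt argument is needed.

/-! ### Homomorphisms that factor through a finite free module -/

section Stable

variable {R : Type*} [Ring R]
  {X Y Z X' Y' : Type*} [AddCommGroup X] [Module R X] [AddCommGroup Y] [Module R Y]
  [AddCommGroup Z] [Module R Z] [AddCommGroup X'] [Module R X'] [AddCommGroup Y'] [Module R Y']

/-- A homomorphism that factors through a finite free module. -/
def FactorsThroughFree (f : X →ₗ[R] Y) : Prop :=
  ∃ (r : ℕ) (α : X →ₗ[R] (Fin r → R)) (β : (Fin r → R) →ₗ[R] Y), f = β ∘ₗ α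

theorem exists_retract_of_finite_projective (P : Type*) [AddCommGroup P] [Module R P]
    [Module.Finite R P] [Module.Projective R P] :
    ∃ (r : ℕ) (i : P →ₗ[R] (Fin r → R)) (p : (Fin r → R) →ₗ[R] P), p ∘ₗ i = LinearMap.id := by
  obtain ⟨r, p, hp⟩ := Module.Finite.exists_fin' R P
  obtain ⟨i, hi⟩ := Module.projective_lifting_property p LinearMap.id hp
  exact ⟨r, i, p, hi⟩

theorem FactorsThroughFree.of_projective {P : Type*} [AddCommGroup P] [Module R P]
    [Module.Finite R P] [Module.Projective R P] (β : P →ₗ[R] Y) (α : X →ₗ[R] P) :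
    FactorsThroughFree (β ∘ₗ α) := by
  obtain ⟨r, i, p, h⟩ := exists_retract_of_finite_projective (R := R) P
  refine ⟨r, i ∘ₗ α, β ∘ₗ p, ?_⟩
  rw [LinearMap.comp_assoc, ← LinearMap.comp_assoc α i p, h, LinearMap.id_comp]

theorem FactorsThroughFree.zero : FactorsThroughFree (0 : X →ₗ[R] Y) :=
  ⟨0, 0, 0, by simp⟩

theorem FactorsThroughFree.add {f g : X →ₗ[R] Y} (hf : FactorsThroughFree f)
    (hg : FactorsThroughFree g) : FactorsThroughFree (f + g) := by
  obtain ⟨r, α, β, rfl⟩ := hf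
  obtain ⟨s, γ, δ, rfl⟩ := hg
  have : β ∘ₗ α + δ ∘ₗ γ = (β.coprod δ) ∘ₗ (α.prod γ) := by ext; simp
  rw [this]
  exact .of_projective _ _

theorem FactorsThroughFree.comp_left {f : X →ₗ[R] Y} (hf : FactorsThroughFree f)
    (g : Y →ₗ[R] Z) : FactorsThroughFree (g ∘ₗ f) := by
  obtain ⟨r, α, β, rfl⟩ := hf
  exact ⟨r, α, g ∘ₗ β, by rw [LinearMap.comp_assoc]⟩

theorem FactorsThroughFree.comp_right {f : Y →ₗ[R] Z} (hf : FactorsThroughFree f)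
    (g : X →ₗ[R] Y) : FactorsThroughFree (f ∘ₗ g) := by
  obtain ⟨r, α, β, rfl⟩ := hf
  exact ⟨r, α ∘ₗ g, β, by rw [LinearMap.comp_assoc]⟩

variable (R X Y Z) in
/-- Isomorphism in the stable category, where homomorphisms are considered up to those factoring
through finite free modules. -/
def StableIso : Prop :=
  ∃ (f : X →ₗ[R] Y) (g : Y →ₗ[R] X),
    FactorsThroughFree (g ∘ₗ f - LinearMap.id) ∧ FactorsThroughFree (f ∘ₗ g - LinearMap.id)

theorem StableIso.of_equiv (e : X ≃ₗ[R] Y) : StableIso R X Y :=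
  ⟨e, e.symm, by simpa using FactorsThroughFree.zero, by simpa using FactorsThroughFree.zero⟩

theorem StableIso.symm (h : StableIso R X Y) : StableIso R Y X := by
  obtain ⟨f, g, h₁, h₂⟩ := h
  exact ⟨g, f, h₂, h₁⟩

/-- The identity behind it is `g g' f' f - 1 = g (g' f' - 1) f + (g f - 1)`. -/
theorem FactorsThroughFree.comp_comp_sub_id {f : X →ₗ[R] Y} {g : Y →ₗ[R] X}
    {f' : Y →ₗ[R] Z} {g' : Z →ₗ[R] Y} (h : FactorsThroughFree (g ∘ₗ f - LinearMap.id))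
    (h' : FactorsThroughFree (g' ∘ₗ f' - LinearMap.id)) :
    FactorsThroughFree ((g ∘ₗ g') ∘ₗ (f' ∘ₗ f) - LinearMap.id) := by
  have := ((h'.comp_right f).comp_left g).add h
  convert this using 1
  ext
  simp

theorem StableIso.trans (h : StableIso R X Y) (h' : StableIso R Y Z) : StableIso R X Z := by
  obtain ⟨f, g, h₁, h₂⟩ := h
  obtain ⟨f', g', h₁', h₂'⟩ := h'
  exact ⟨f' ∘ₗ f, g ∘ₗ g', h₁.comp_comp_sub_id h₁', h₂'.comp_comp_sub_id h₂⟩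

/-- A lift of a homomorphism to projective presentations. -/
theorem exists_lift_of_exact {K P K' P' : Type*} [AddCommGroup K] [Module R K] [AddCommGroup P]
    [Module R P] [AddCommGroup K'] [Module R K'] [AddCommGroup P'] [Module R P']
    [Module.Projective R P] {i : K →ₗ[R] P} {p : P →ₗ[R] X} {i' : K' →ₗ[R] P'} {p' : P' →ₗ[R] X'}
    (h : Function.Exact i p) (hi' : Function.Injective i') (h' : Function.Exact i' p')
    (hp' : Function.Surjective p') (f : X →ₗ[R] X') :
    ∃ (F : P →ₗ[R] P') (G : K →ₗ[R] K'), p' ∘ₗ F = f ∘ₗ p ∧ i' ∘ₗ G = F ∘ₗ i := by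
  obtain ⟨F, hF⟩ := Module.projective_lifting_property p' (f ∘ₗ p) hp'
  have hr : ∀ x, (F ∘ₗ i) x ∈ LinearMap.range i' := fun x ↦ by
    refine (h' _).1 ?_
    have := LinearMap.congr_fun hF (i x)
    simp only [LinearMap.comp_apply] at this ⊢
    rw [this, h.apply_apply_eq_zero, map_zero]
  let e := LinearEquiv.ofInjective i' hi'
  refine ⟨F, e.symm.toLinearMap ∘ₗ (F ∘ₗ i).codRestrict _ hr, hF, ?_⟩
  ext x
  have := LinearEquiv.ofInjective_apply (h := hi') i' (e.symm ((F ∘ₗ i).codRestrict _ hr x))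
  simp [e] at this ⊢

/-- If `f - 1 = β α` with `β = p γ`, then `F - 1 - γ α p` is killed by `p`, hence maps `P` into `K`.
On `K` the term `γ α p` vanishes, so `G - 1` is the restriction of this map and factors through `P`.
-/
theorem factorsThroughFree_of_exact {K P : Type*} [AddCommGroup K] [Module R K]
    [AddCommGroup P] [Module R P] [Module.Finite R P] [Module.Projective R P]
    {i : K →ₗ[R] P} {p : P →ₗ[R] X} (hi : Function.Injective i) (h : Function.Exact i p)
    (hp : Function.Surjective p) {f : X →ₗ[R] X} (hf : FactorsThroughFree (f - LinearMap.id))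
    {F : P →ₗ[R] P} {G : K →ₗ[R] K} (hF : p ∘ₗ F = f ∘ₗ p) (hG : i ∘ₗ G = F ∘ₗ i) :
    FactorsThroughFree (G - LinearMap.id) := by
  obtain ⟨r, α, β, hαβ⟩ := hf
  obtain ⟨γ, rfl⟩ := Module.projective_lifting_property p β hp
  have hr : ∀ x, (F - LinearMap.id - γ ∘ₗ α ∘ₗ p : P →ₗ[R] P) x ∈ LinearMap.range i := fun x ↦ by
    refine (h _).1 ?_
    have h₁ := LinearMap.congr_fun hF x
    have h₂ := LinearMap.congr_fun hαβ (p x)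
    simp only [LinearMap.comp_apply, LinearMap.sub_apply, LinearMap.id_apply] at h₁ h₂ ⊢
    rw [map_sub, map_sub, h₁, h₂, sub_self]
  let e := LinearEquiv.ofInjective i hi
  convert FactorsThroughFree.of_projective
    (e.symm.toLinearMap ∘ₗ (F - LinearMap.id - γ ∘ₗ α ∘ₗ p : P →ₗ[R] P).codRestrict _ hr) i using 1
  ext x
  apply hi
  have h₁ := LinearEquiv.ofInjective_apply (h := hi) i
    (e.symm ((F - LinearMap.id - γ ∘ₗ α ∘ₗ p : P →ₗ[R] P).codRestrict _ hr (i x)))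
  have h₂ := LinearMap.congr_fun hG x
  simp only [LinearMap.comp_apply] at h₂
  simp only [LinearMap.sub_apply, map_sub, h₂, LinearMap.comp_apply, LinearEquiv.coe_coe]
  rw [← h₁]
  simp [e, h.apply_apply_eq_zero]

/-- A stable form of Schanuel's lemma: mutually inverse stable maps lift to the presentations, and
each composite of the lifts lies over a map that is stably the identity. -/
theorem StableIso.of_exact {K P K' P' : Type*} [AddCommGroup K] [Module R K] [AddCommGroup P]
    [Module R P] [AddCommGroup K'] [Module R K'] [AddCommGroup P'] [Module R P']
    [Module.Finite R P] [Module.Projective R P] [Module.Finite R P'] [Module.Projective R P']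
    {i : K →ₗ[R] P} {p : P →ₗ[R] X} {i' : K' →ₗ[R] P'} {p' : P' →ₗ[R] X'}
    (hi : Function.Injective i) (h : Function.Exact i p) (hp : Function.Surjective p)
    (hi' : Function.Injective i') (h' : Function.Exact i' p') (hp' : Function.Surjective p')
    (hX : StableIso R X X') : StableIso R K K' := by
  obtain ⟨f, g, hgf, hfg⟩ := hX
  obtain ⟨F, G, hF, hG⟩ := exists_lift_of_exact h hi' h' hp' f
  obtain ⟨F', G', hF', hG'⟩ := exists_lift_of_exact h' hi h hp g
  refine ⟨G, G', factorsThroughFree_of_exact hi h hp hgf (F := F' ∘ₗ F) ?_ ?_,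
    factorsThroughFree_of_exact hi' h' hp' hfg (F := F ∘ₗ F') ?_ ?_⟩
  · rw [← LinearMap.comp_assoc, hF', LinearMap.comp_assoc, hF, LinearMap.comp_assoc]
  · rw [← LinearMap.comp_assoc, hG', LinearMap.comp_assoc, hG, LinearMap.comp_assoc]
  · rw [← LinearMap.comp_assoc, hF, LinearMap.comp_assoc, hF', LinearMap.comp_assoc]
  · rw [← LinearMap.comp_assoc, hG, LinearMap.comp_assoc, hG', LinearMap.comp_assoc]

/-- A stable isomorphism makes each module a direct summand of the other one up to a finite free
module, with a projective complement. -/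
theorem StableIso.exists_retract (h : StableIso R X Y) :
    ∃ (r : ℕ) (i : X →ₗ[R] Y × (Fin r → R)) (p : Y × (Fin r → R) →ₗ[R] X),
      p ∘ₗ i = LinearMap.id ∧ FactorsThroughFree (LinearMap.id - i ∘ₗ p) := by
  obtain ⟨f, g, ⟨r, α, β, h⟩, h'⟩ := h
  -- Here `g f - 1 = β α`, so the composite `g f - β α` is the identity exactly, not merely stably.
  refine ⟨r, f.prod α, g.coprod (-β), ?_, ?_⟩
  · ext x
    have := LinearMap.congr_fun h x
    simp only [LinearMap.sub_apply, LinearMap.comp_apply, LinearMap.id_apply] at this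
    simp [← this]
  · obtain ⟨s, γ, δ, h'⟩ := h'
    -- The first coordinate of the complementary idempotent is `-(f g - 1) y₁ + f β y₂` with `f g -
    -- 1 = δ γ`; the second already takes values in a free module.
    have key : LinearMap.id - (f.prod α) ∘ₗ (g.coprod (-β)) =
        (LinearMap.inl R Y (Fin r → R) ∘ₗ (-δ)) ∘ₗ (γ ∘ₗ LinearMap.fst R Y (Fin r → R)) +
        ((LinearMap.inl R Y (Fin r → R) ∘ₗ f ∘ₗ β) ∘ₗ LinearMap.snd R Y (Fin r → R) +
        LinearMap.inr R Y (Fin r → R) ∘ₗ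
          (LinearMap.snd R Y (Fin r → R) - α ∘ₗ g.coprod (-β))) := by
      refine LinearMap.ext fun y ↦ ?_
      have := LinearMap.congr_fun h' y.1
      simp only [LinearMap.sub_apply, LinearMap.comp_apply, LinearMap.id_apply] at this
      ext1
      · simp [← this, sub_eq_add_neg, add_assoc, add_comm]
      · simp
    rw [key]
    exact (FactorsThroughFree.of_projective _ _).add
      ((FactorsThroughFree.of_projective _ _).add (FactorsThroughFree.of_projective _ _))

end Stable

theorem StablyIsomorphic.stableIso {R : Type u} [Ring R] {X Y : Type*} [AddCommGroup X]
    [Module R X] [AddCommGroup Y] [Module R Y] (h : StablyIsomorphic R X Y) :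
    StableIso R X Y := by
  obtain ⟨f, g, ⟨P, _, _, α, β, h₁⟩, ⟨Q, _, _, γ, δ, h₂⟩⟩ := h
  exact ⟨f, g, h₁ ▸ .of_projective _ _, h₂ ▸ .of_projective _ _⟩

/-! ### Projective covers and syzygies -/

section Syzygy

variable {R : Type u} [Ring R]

/-- Lifts of a finite generating set of `X` span a submodule that together with the superfluous
kernel gives all of `P`, so they generate `P`. -/
theorem IsProjectiveCover.finite {P X : Type*} [AddCommGroup P] [Module R P] [AddCommGroup X]
    [Module R X] [Module.Finite R X] {f : P →ₗ[R] X} (hf : IsProjectiveCover f) :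
    Module.Finite R P := by
  classical
  obtain ⟨-, hs, hL⟩ := hf
  obtain ⟨s, hspan⟩ := Module.Finite.fg_top (R := R) (M := X)
  choose g hg using hs
  refine ⟨⟨s.image g, hL _ (eq_top_iff.2 fun x _ ↦ ?_)⟩⟩
  have hx : f x ∈ Submodule.map f (Submodule.span R (s.image g : Finset P)) := by
    rw [Submodule.map_span, Finset.coe_image, ← Set.image_comp,
      show f ∘ g = id from funext hg, Set.image_id, hspan]
    trivial
  obtain ⟨y, hy, hyx⟩ := hx
  rw [← sub_add_cancel x y]
  exact Submodule.add_mem_sup (by simp [hyx]) hy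

/-- Over an Artinian ring, every finitely generated module has a projective cover. -/
theorem exists_isProjectiveCover [IsArtinianRing R] (X : Type*) [AddCommGroup X]
    [Module R X] [Module.Finite R X] :
    ∃ (P : ModuleCat.{u} R) (f : P →ₗ[R] X), IsProjectiveCover f := by
  obtain ⟨r, f, hf⟩ := Module.Finite.exists_fin' R X
  -- The cover will be a minimal direct summand of `Rʳ` on which `f` is still surjective; the map
  -- `e` records the projection onto the summand.
  let S : Set (Submodule R (Fin r → R)) :=
    {Q | (∃ e : (Fin r → R) →ₗ[R] Q, ∀ x : Q, e x = x) ∧ ∀ x, ∃ y ∈ Q, f y = x}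
  have hS : S.Nonempty := ⟨⊤, ⟨LinearMap.codRestrict ⊤ LinearMap.id (by simp), fun _ ↦ rfl⟩,
    fun x ↦ by simpa using hf x⟩
  obtain ⟨Q, ⟨⟨e, he⟩, hQ⟩, hmin⟩ := IsWellFounded.wf.has_min (r := (· < ·)) S hS
  have hproj : Module.Projective R Q := Module.Projective.of_split Q.subtype e (by ext x; simp [he])
  have hfin : Module.Finite R Q := Module.Finite.of_surjective e fun x ↦ ⟨x, he x⟩
  refine ⟨ModuleCat.of R Q, f ∘ₗ Q.subtype, hproj, fun x ↦ ?_, fun L hL ↦ ?_⟩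
  · obtain ⟨y, hy, rfl⟩ := hQ x
    exact ⟨⟨y, hy⟩, rfl⟩
  change Submodule R Q at L
  have hLs : Function.Surjective ((f ∘ₗ Q.subtype) ∘ₗ L.subtype) := fun x ↦ by
    obtain ⟨y, hy, rfl⟩ := hQ x
    have : (⟨y, hy⟩ : Q) ∈ LinearMap.ker (f ∘ₗ Q.subtype) ⊔ L := hL ▸ Submodule.mem_top
    obtain ⟨a, ha, b, hb, hab⟩ := Submodule.mem_sup.1 this
    refine ⟨⟨b, hb⟩, ?_⟩
    have ha' : f a = 0 := ha
    have := congrArg (fun t : Q ↦ f t) hab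
    simpa [ha'] using this
  -- If `ker + L = ⊤`, then `f` on `Q` lifts through `L`, giving an endomorphism `φ` of `Q` over `f`
  -- with image in `L`. By Fitting's lemma the range of some `φ ^ n`, `n ≥ 1`, is a summand of `Q`;
  -- `f` is surjective on it, so minimality forces it, and hence `L`, to be all of `Q`.
  obtain ⟨g, hg⟩ := Module.projective_lifting_property _ (f ∘ₗ Q.subtype) hLs
  let φ : Module.End R Q := L.subtype ∘ₗ g
  have hφ : (f ∘ₗ Q.subtype) ∘ₗ φ = f ∘ₗ Q.subtype := hg
  have hφn : ∀ n x, f ((φ ^ n) x : Q) = f x := fun n ↦ by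
    induction n with
    | zero => simp
    | succ n ih =>
      intro x
      rw [pow_succ, Module.End.mul_apply, ih]
      exact LinearMap.congr_fun hφ x
  obtain ⟨n, hn, hn1⟩ := ((φ.eventually_isCompl_ker_pow_range_pow).and
    (Filter.eventually_ge_atTop 1)).exists
  have hrange : LinearMap.range (φ ^ n) ≤ L := by
    rintro _ ⟨x, rfl⟩
    obtain ⟨m, rfl⟩ := Nat.exists_eq_add_of_le' hn1
    rw [pow_succ', Module.End.mul_apply]
    exact (g _).2
  by_contra hne
  refine hmin (Submodule.map Q.subtype (LinearMap.range (φ ^ n))) ⟨⟨?_, ?_⟩, ?_⟩ ?_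
  · let π := Submodule.projectionOnto _ _ hn.symm
    exact ((Submodule.equivMapOfInjective Q.subtype Q.injective_subtype
      (LinearMap.range (φ ^ n))).toLinearMap ∘ₗ π) ∘ₗ e
  · rintro ⟨_, ⟨y, hy, rfl⟩⟩
    have h₁ : e y = y := he y
    have h₂ := Submodule.projectionOnto_apply_left hn.symm ⟨y, hy⟩
    simp only [LinearMap.comp_apply, Submodule.subtype_apply, h₁, LinearEquiv.coe_coe]
    rw [h₂]
    rfl
  · intro x
    obtain ⟨y, hy, rfl⟩ := hQ x
    exact ⟨_, ⟨_, ⟨⟨y, hy⟩, rfl⟩, rfl⟩, hφn n ⟨y, hy⟩⟩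
  · refine lt_of_le_of_ne (Submodule.map_subtype_le _ _) fun heq ↦ hne (eq_top_iff.2 ?_)
    refine le_trans (fun (x : Q) _ ↦ ?_) hrange
    have : (x : Fin r → R) ∈ Submodule.map Q.subtype (LinearMap.range (φ ^ n)) := by
      rw [heq]
      exact x.2
    obtain ⟨y, hy, hyx⟩ := this
    rwa [← show y = x from Subtype.ext hyx]

theorem IsSyzygy.finite [IsNoetherianRing R] {X : Type*} [AddCommGroup X] [Module R X]
    [Module.Finite R X] {n : ℕ} {Z : ModuleCat.{u} R} (h : IsSyzygy R X n Z) :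
    Module.Finite R Z := by
  induction n generalizing Z with
  | zero => obtain ⟨e⟩ := h; exact Module.Finite.equiv e.symm
  | succ n ih =>
    obtain ⟨K, hK, P, f, hf, ⟨e⟩⟩ := h
    have := ih hK
    have := hf.finite
    exact Module.Finite.equiv e.symm

theorem exists_isSyzygy [IsArtinianRing R] {X : Type u} [AddCommGroup X] [Module R X]
    [Module.Finite R X] (n : ℕ) : ∃ Z : ModuleCat.{u} R, IsSyzygy R X n Z := by
  induction n with
  | zero => exact ⟨ModuleCat.of R X, ⟨.refl R X⟩⟩
  | succ n ih =>
    obtain ⟨K, hK⟩ := ih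
    have := hK.finite
    obtain ⟨P, f, hf⟩ := exists_isProjectiveCover (R := R) K
    exact ⟨ModuleCat.of R (LinearMap.ker f), K, hK, P, f, hf, ⟨.refl R _⟩⟩

theorem IsSyzygy.of_equiv {X : Type*} [AddCommGroup X] [Module R X] {n : ℕ}
    {Z Z' : ModuleCat.{u} R} (h : IsSyzygy R X n Z) (e : Z' ≃ₗ[R] Z) : IsSyzygy R X n Z' := by
  cases n with
  | zero => exact ⟨e.trans h.some⟩
  | succ n =>
    obtain ⟨K, hK, P, f, hf, ⟨e'⟩⟩ := h
    exact ⟨K, hK, P, f, hf, ⟨e.trans e'⟩⟩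

theorem IsSyzygy.comp {X : Type*} [AddCommGroup X] [Module R X] {l n : ℕ}
    {W Z : ModuleCat.{u} R} (h : IsSyzygy R X l W) (h' : IsSyzygy R W n Z) :
    IsSyzygy R X (l + n) Z := by
  induction n generalizing Z with
  | zero => exact h.of_equiv h'.some
  | succ n ih =>
    obtain ⟨K, hK, P, f, hf, e⟩ := h'
    exact ⟨K, ih hK, P, f, hf, e⟩

/-- The short exact sequence that defines a syzygy. -/
theorem IsSyzygy.exists_exact [IsNoetherianRing R] {X : Type*} [AddCommGroup X] [Module R X]
    [Module.Finite R X] {n : ℕ} {Z : ModuleCat.{u} R} (h : IsSyzygy R X (n + 1) Z) :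
    ∃ K P : ModuleCat.{u} R, IsSyzygy R X n K ∧ Module.Finite R P ∧ Module.Projective R P ∧
      ∃ (i : Z →ₗ[R] P) (p : P →ₗ[R] K),
        Function.Injective i ∧ Function.Exact i p ∧ Function.Surjective p := by
  obtain ⟨K, hK, P, f, hf, ⟨e⟩⟩ := h
  have := hK.finite
  refine ⟨K, P, hK, hf.finite, hf.1, (LinearMap.ker f).subtype ∘ₗ e.toLinearMap, f,
    (LinearMap.ker f).injective_subtype.comp e.injective, ?_, hf.2.1⟩
  rw [LinearMap.exact_iff, LinearMap.range_comp, LinearEquiv.range]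
  simp

end Syzygy

/-! ### The balanced tensor product over a noncommutative ring -/

/-- The tensor product `E ⊗_S Y` of a right `S`-module `E` and a left `S`-module `Y`. -/
def BalancedTensor (S E Y : Type*) [Ring S] [AddCommGroup E] [Module Sᵐᵒᵖ E] [AddCommGroup Y]
    [Module S Y] : Type _ :=
  (E ⊗[ℤ] Y) ⧸ AddSubgroup.closure
    {t : E ⊗[ℤ] Y | ∃ (e : E) (s : S) (y : Y),
      t = (MulOpposite.op s • e) ⊗ₜ[ℤ] y - e ⊗ₜ[ℤ] (s • y)}

namespace BalancedTensor

section Additive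

variable {S E E' E'' Y Y' Y'' G : Type*} [Ring S] [AddCommGroup E] [Module Sᵐᵒᵖ E]
  [AddCommGroup E'] [Module Sᵐᵒᵖ E'] [AddCommGroup E''] [Module Sᵐᵒᵖ E'']
  [AddCommGroup Y] [Module S Y] [AddCommGroup Y'] [Module S Y'] [AddCommGroup Y''] [Module S Y'']
  [AddCommGroup G]

instance : AddCommGroup (BalancedTensor S E Y) :=
  inferInstanceAs (AddCommGroup ((E ⊗[ℤ] Y) ⧸ AddSubgroup.closure _))

/-- A pure tensor. -/
def tmul (S : Type*) [Ring S] [Module Sᵐᵒᵖ E] [Module S Y] (e : E) (y : Y) :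
    BalancedTensor S E Y :=
  QuotientAddGroup.mk (e ⊗ₜ[ℤ] y)

theorem add_tmul (e e' : E) (y : Y) : tmul S (e + e') y = tmul S e y + tmul S e' y :=
  congrArg QuotientAddGroup.mk (TensorProduct.add_tmul e e' y)

theorem tmul_add (e : E) (y y' : Y) : tmul S e (y + y') = tmul S e y + tmul S e y' :=
  congrArg QuotientAddGroup.mk (TensorProduct.tmul_add e y y')

theorem op_smul_tmul (e : E) (s : S) (y : Y) :
    tmul S (MulOpposite.op s • e) y = tmul S e (s • y) := by
  refine (QuotientAddGroup.eq_iff_sub_mem).2 (AddSubgroup.subset_closure ⟨e, s, y, rfl⟩)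

/-- The biadditive map to the tensor product. -/
def mk (S E Y : Type*) [Ring S] [AddCommGroup E] [Module Sᵐᵒᵖ E] [AddCommGroup Y]
    [Module S Y] : E →+ Y →+ BalancedTensor S E Y :=
  AddMonoidHom.mk' (fun e ↦ AddMonoidHom.mk' (tmul S e) (tmul_add e))
    (fun e e' ↦ AddMonoidHom.ext fun y ↦ add_tmul e e' y)

theorem mk_apply (e : E) (y : Y) : mk S E Y e y = tmul S e y := rfl

theorem zero_tmul (y : Y) : tmul S (0 : E) y = 0 := by
  rw [← mk_apply, map_zero, AddMonoidHom.zero_apply]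

theorem tmul_zero (e : E) : tmul S e (0 : Y) = 0 := by
  rw [← mk_apply, map_zero]

theorem sum_tmul {ι : Type*} (s : Finset ι) (e : ι → E) (y : Y) :
    tmul S (∑ i ∈ s, e i) y = ∑ i ∈ s, tmul S (e i) y := by
  simp only [← mk_apply, map_sum, AddMonoidHom.finsetSum_apply]

@[elab_as_elim]
theorem induction {p : BalancedTensor S E Y → Prop} (t : BalancedTensor S E Y) (zero : p 0)
    (tmul : ∀ e y, p (tmul S e y)) (add : ∀ s t, p s → p t → p (s + t)) : p t := by
  obtain ⟨t, rfl⟩ := QuotientAddGroup.mk_surjective t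
  induction t using TensorProduct.induction_on with
  | zero => exact zero
  | tmul e y => exact tmul e y
  | add s t hs ht => exact add _ _ hs ht

theorem hom_ext {f g : BalancedTensor S E Y →+ G} (h : ∀ e y, f (tmul S e y) = g (tmul S e y)) :
    f = g := by
  ext t
  induction t using BalancedTensor.induction with
  | zero => rw [map_zero, map_zero]
  | tmul e y => exact h e y
  | add s t hs ht => rw [map_add, map_add, hs, ht]

/-- The universal property of the tensor product. -/
def lift (φ : E →+ Y →+ G) (h : ∀ e (s : S) y, φ (MulOpposite.op s • e) y = φ e (s • y)) :
    BalancedTensor S E Y →+ G :=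
  QuotientAddGroup.lift _
    (TensorProduct.liftAddHom φ fun r e y ↦ by
      rw [map_zsmul, map_zsmul, AddMonoidHom.zsmul_apply]) (by
    rw [AddSubgroup.closure_le]
    rintro _ ⟨e, s, y, rfl⟩
    change (TensorProduct.liftAddHom φ _) _ = 0
    rw [map_sub, TensorProduct.liftAddHom_tmul, TensorProduct.liftAddHom_tmul, h, sub_self])

theorem lift_tmul (φ : E →+ Y →+ G) (h) (e : E) (y : Y) :
    lift (S := S) φ h (tmul S e y) = φ e y := rfl

/-- The homomorphism `f ⊗ g` of abelian groups. -/
def map (f : E →ₗ[Sᵐᵒᵖ] E') (g : Y →ₗ[S] Y') : BalancedTensor S E Y →+ BalancedTensor S E' Y' :=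
  lift (((mk S E' Y').comp f.toAddMonoidHom).compr₂ (.id _) |>.compl₂ g.toAddMonoidHom)
    fun e s y ↦ by
      change tmul S (f _) (g y) = tmul S (f e) (g _)
      rw [map_smul, map_smul, op_smul_tmul]

theorem map_tmul (f : E →ₗ[Sᵐᵒᵖ] E') (g : Y →ₗ[S] Y') (e : E) (y : Y) :
    map f g (tmul S e y) = tmul S (f e) (g y) := rfl

theorem map_comp_apply (f : E →ₗ[Sᵐᵒᵖ] E') (g : Y →ₗ[S] Y') (f' : E' →ₗ[Sᵐᵒᵖ] E'')
    (g' : Y' →ₗ[S] Y'') (t : BalancedTensor S E Y) :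
    map (f' ∘ₗ f) (g' ∘ₗ g) t = map f' g' (map f g t) :=
  DFunLike.congr_fun (hom_ext (f := map (f' ∘ₗ f) (g' ∘ₗ g)) (g := (map f' g').comp (map f g))
    fun _ _ ↦ rfl) t

theorem map_id_apply (t : BalancedTensor S E Y) :
    map LinearMap.id LinearMap.id t = t :=
  DFunLike.congr_fun (hom_ext (f := map .id .id) (g := .id _) fun _ _ ↦ rfl) t

theorem map_add_left_apply (f f' : E →ₗ[Sᵐᵒᵖ] E') (g : Y →ₗ[S] Y') (t : BalancedTensor S E Y) :
    map (f + f') g t = map f g t + map f' g t :=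
  DFunLike.congr_fun (hom_ext (g := map f g + map f' g) fun _ _ ↦ add_tmul _ _ _) t

end Additive

section Bimodule

variable {C S E E' E'' Y Y' Y'' : Type*} [Ring C] [Ring S]
  [AddCommGroup E] [Module Sᵐᵒᵖ E] [Module C E] [SMulCommClass C Sᵐᵒᵖ E]
  [AddCommGroup E'] [Module Sᵐᵒᵖ E'] [Module C E'] [SMulCommClass C Sᵐᵒᵖ E']
  [AddCommGroup E''] [Module Sᵐᵒᵖ E''] [Module C E''] [SMulCommClass C Sᵐᵒᵖ E'']
  [AddCommGroup Y] [Module S Y] [AddCommGroup Y'] [Module S Y'] [AddCommGroup Y''] [Module S Y'']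

instance : SMul C (BalancedTensor S E Y) where
  smul c t := map
    { toFun := fun e ↦ c • e
      map_add' := smul_add c
      map_smul' := fun s e ↦ smul_comm c s e } LinearMap.id t

theorem smul_tmul (c : C) (e : E) (y : Y) : c • tmul S e y = tmul S (c • e) y := rfl

instance : DistribSMul C (BalancedTensor S E Y) where
  smul_zero _ := map_zero (map (S := S) _ _)
  smul_add _ := map_add (map (S := S) _ _)

instance : Module C (BalancedTensor S E Y) where
  one_smul t := by
    induction t using BalancedTensor.induction with
    | zero => rw [smul_zero]
    | tmul e y => rw [smul_tmul, one_smul]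
    | add s t hs ht => rw [smul_add, hs, ht]
  mul_smul c d t := by
    induction t using BalancedTensor.induction with
    | zero => simp only [smul_zero]
    | tmul e y => simp only [smul_tmul, mul_smul]
    | add s t hs ht => simp only [smul_add, hs, ht]
  smul_zero := smul_zero
  smul_add := smul_add
  add_smul c d t := by
    induction t using BalancedTensor.induction with
    | zero => simp only [smul_zero, add_zero]
    | tmul e y => simp only [smul_tmul, add_smul, add_tmul]
    | add s t hs ht => simp only [smul_add, hs, ht, add_add_add_comm]
  zero_smul t := by
    induction t using BalancedTensor.induction with
    | zero => rw [smul_zero]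
    | tmul e y => rw [smul_tmul, zero_smul, zero_tmul]
    | add s t hs ht => rw [smul_add, hs, ht, add_zero]

/-- An additive map on the tensor product that commutes with the left action on pure tensors is
linear. -/
def toLinearMap {G : Type*} [AddCommGroup G] [Module C G] (f : BalancedTensor S E Y →+ G)
    (h : ∀ (c : C) e y, f (tmul S (c • e) y) = c • f (tmul S e y)) :
    BalancedTensor S E Y →ₗ[C] G where
  __ := f
  map_smul' c t := by
    change f (c • t) = c • f t
    induction t using BalancedTensor.induction with
    | zero => rw [smul_zero, map_zero, smul_zero]
    | tmul e y => exact h c e y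
    | add s t hs ht => rw [smul_add, map_add, map_add, smul_add, hs, ht]

theorem linearMap_ext {G : Type*} [AddCommGroup G] [Module C G]
    {f g : BalancedTensor S E Y →ₗ[C] G} (h : ∀ e y, f (tmul S e y) = g (tmul S e y)) : f = g :=
  LinearMap.toAddMonoidHom_injective (hom_ext h)

variable (C E) in
/-- The functor `E ⊗_S -` on homomorphisms. -/
def lTensor (g : Y →ₗ[S] Y') : BalancedTensor S E Y →ₗ[C] BalancedTensor S E Y' :=
  toLinearMap (map LinearMap.id g) fun _ _ _ ↦ rfl

theorem lTensor_tmul (g : Y →ₗ[S] Y') (e : E) (y : Y) :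
    lTensor C E g (tmul S e y) = tmul S e (g y) := rfl

theorem lTensor_comp (g : Y →ₗ[S] Y') (g' : Y' →ₗ[S] Y'') :
    lTensor C E (g' ∘ₗ g) = lTensor C E g' ∘ₗ lTensor C E g :=
  linearMap_ext fun _ _ ↦ rfl

theorem lTensor_id : lTensor C E (LinearMap.id : Y →ₗ[S] Y) = LinearMap.id :=
  linearMap_ext fun _ _ ↦ rfl

theorem lTensor_sub (g g' : Y →ₗ[S] Y') :
    lTensor C E (g - g') = lTensor C E g - lTensor C E g' :=
  linearMap_ext fun e _ ↦ map_sub (mk S E Y' e) _ _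

variable (C Y) in
/-- The functor `- ⊗_S Y` on bimodule homomorphisms. -/
def rTensor (f : E →ₗ[Sᵐᵒᵖ] E') (hf : ∀ (c : C) e, f (c • e) = c • f e) :
    BalancedTensor S E Y →ₗ[C] BalancedTensor S E' Y :=
  toLinearMap (map f LinearMap.id) fun c e y ↦ by
    rw [map_tmul, map_tmul, hf, smul_tmul]

end Bimodule

end BalancedTensor

-- Exactness of `E ⊗_S -`, and its effect on finite and projective modules

namespace BalancedTensor

section Exactness

variable {C S E Y Y' Y'' : Type*} [Ring C] [Ring S]
  [AddCommGroup E] [Module Sᵐᵒᵖ E] [Module C E] [SMulCommClass C Sᵐᵒᵖ E]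
  [AddCommGroup Y] [Module S Y] [AddCommGroup Y'] [Module S Y'] [AddCommGroup Y''] [Module S Y'']

variable (S E) in
/-- A finite projective right module has a finite dual basis. -/
theorem exists_finite_dual_basis [Module.Finite Sᵐᵒᵖ E] [Module.Projective Sᵐᵒᵖ E] :
    ∃ (r : ℕ) (i : E →ₗ[Sᵐᵒᵖ] (Fin r → Sᵐᵒᵖ)) (x : Fin r → E),
      ∀ e, ∑ j, i e j • x j = e := by
  obtain ⟨r, i, p, h⟩ := exists_retract_of_finite_projective (R := Sᵐᵒᵖ) E
  refine ⟨r, i, fun j ↦ p (Pi.single j 1), fun e ↦ ?_⟩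
  simp only [← map_smul, ← map_sum]
  refine Eq.trans (congrArg p ?_) (LinearMap.congr_fun h e)
  ext j
  simp [Finset.sum_apply, Pi.single_apply]

/-- The coordinates `e ⊗ y ↦ φ(e) y` given by a functional `φ` on `E`. -/
def coord (φ : E →ₗ[Sᵐᵒᵖ] Sᵐᵒᵖ) : BalancedTensor S E Y →+ Y :=
  lift (AddMonoidHom.mk' (fun e ↦ DistribSMul.toAddMonoidHom Y (φ e).unop) fun e e' ↦ by
    ext y
    simp [add_smul]) fun e s y ↦ by
      simp [mul_smul]

theorem coord_lTensor (φ : E →ₗ[Sᵐᵒᵖ] Sᵐᵒᵖ) (g : Y →ₗ[S] Y') (t : BalancedTensor S E Y) :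
    coord φ (lTensor C E g t) = g (coord φ t) := by
  refine DFunLike.congr_fun (hom_ext (f := (coord φ).comp (lTensor C E g).toAddMonoidHom)
    (g := g.toAddMonoidHom.comp (coord φ)) fun e y ↦ ?_) t
  exact (map_smul g _ _).symm

/-- Expanding `e` in the dual basis and moving the coefficients across the tensor sign shows that a
tensor is determined by its coordinates in `Y`. -/
theorem sum_tmul_coord {r : ℕ} {i : E →ₗ[Sᵐᵒᵖ] (Fin r → Sᵐᵒᵖ)} {x : Fin r → E}
    (h : ∀ e, ∑ j, i e j • x j = e) (t : BalancedTensor S E Y) :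
    ∑ j, tmul S (x j) (coord (LinearMap.proj j ∘ₗ i) t) = t := by
  induction t using BalancedTensor.induction with
  | zero => simp [tmul_zero]
  | tmul e y =>
    conv_rhs => rw [← h e, sum_tmul]
    exact Finset.sum_congr rfl fun j _ ↦ (op_smul_tmul (x j) (i e j).unop y).symm
  | add s t hs ht => simp [tmul_add, Finset.sum_add_distrib, hs, ht]

/-- Coordinates commute with `g`, so a tensor in the kernel has all its coordinates in `ker g`;
preimages under `f` reassemble, through the dual basis, into a preimage of the tensor. -/
theorem lTensor_exact [Module.Finite Sᵐᵒᵖ E] [Module.Projective Sᵐᵒᵖ E] {f : Y →ₗ[S] Y'}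
    {g : Y' →ₗ[S] Y''} (h : Function.Exact f g) :
    Function.Exact (lTensor C E f) (lTensor C E g) := by
  obtain ⟨r, i, x, hx⟩ := exists_finite_dual_basis S E
  intro t
  constructor
  · intro ht
    have hc : ∀ j, g (coord (LinearMap.proj j ∘ₗ i) t) = 0 := fun j ↦ by
      rw [← coord_lTensor (C := C), ht, map_zero]
    choose y hy using fun j ↦ (h _).1 (hc j)
    refine ⟨∑ j, tmul S (x j) (y j), ?_⟩
    rw [map_sum, ← sum_tmul_coord hx t]
    exact Finset.sum_congr rfl fun j _ ↦ by rw [lTensor_tmul, hy]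
  · rintro ⟨t, rfl⟩
    rw [← LinearMap.comp_apply, ← lTensor_comp, h.linearMap_comp_eq_zero]
    have := lTensor_sub (C := C) (E := E) (0 : Y →ₗ[S] Y'') 0
    rw [sub_self, sub_self] at this
    rw [this, LinearMap.zero_apply]

theorem lTensor_injective [Module.Finite Sᵐᵒᵖ E] [Module.Projective Sᵐᵒᵖ E] {f : Y →ₗ[S] Y'}
    (hf : Function.Injective f) : Function.Injective (lTensor C E f) := by
  obtain ⟨r, i, x, hx⟩ := exists_finite_dual_basis S E
  intro s t hst
  rw [← sum_tmul_coord hx s, ← sum_tmul_coord hx t]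
  refine Finset.sum_congr rfl fun j _ ↦ ?_
  congr 1
  apply hf
  rw [← coord_lTensor (C := C), hst, coord_lTensor]

theorem lTensor_surjective {f : Y →ₗ[S] Y'} (hf : Function.Surjective f) :
    Function.Surjective (lTensor C E f) := fun t ↦ by
  induction t using BalancedTensor.induction with
  | zero => exact ⟨0, map_zero _⟩
  | tmul e y =>
    obtain ⟨y, rfl⟩ := hf y
    exact ⟨tmul S e y, rfl⟩
  | add s t hs ht =>
    obtain ⟨s, rfl⟩ := hs
    obtain ⟨t, rfl⟩ := ht
    exact ⟨s + t, map_add _ _ _⟩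

/-- The isomorphism `E ⊗_S Y ≃ E ⊗_S Y'` induced by `Y ≃ Y'`. -/
def lCongr (C E : Type*) [Ring C] [AddCommGroup E] [Module Sᵐᵒᵖ E] [Module C E]
    [SMulCommClass C Sᵐᵒᵖ E] (g : Y ≃ₗ[S] Y') :
    BalancedTensor S E Y ≃ₗ[C] BalancedTensor S E Y' :=
  .ofLinearMap (lTensor C E g) (lTensor C E g.symm)
    (by rw [← lTensor_comp, g.comp_symm, lTensor_id])
    (by rw [← lTensor_comp, g.symm_comp, lTensor_id])

-- A one-sided inverse to the comparison with `Eʳ` is enough to transfer finiteness and projectivity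
-- from `E`.
variable (C S E) in
theorem exists_retract_of_pi (r : ℕ) :
    ∃ (i : BalancedTensor S E (Fin r → S) →ₗ[C] (Fin r → E))
      (p : (Fin r → E) →ₗ[C] BalancedTensor S E (Fin r → S)), p ∘ₗ i = LinearMap.id := by
  let i : BalancedTensor S E (Fin r → S) →ₗ[C] (Fin r → E) := toLinearMap
    (lift (AddMonoidHom.mk' (fun e ↦ AddMonoidHom.mk' (fun v j ↦ MulOpposite.op (v j) • e)
      fun v w ↦ by ext j; simp [add_smul]) fun e e' ↦ by ext v j; simp)
      fun e s v ↦ by ext j; simp [mul_smul])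
    fun c e v ↦ by
      ext j
      exact (smul_comm c (MulOpposite.op (v j)) e).symm
  let p : (Fin r → E) →ₗ[C] BalancedTensor S E (Fin r → S) :=
    { toFun := fun w ↦ ∑ j, tmul S (w j) (Pi.single j 1)
      map_add' := fun v w ↦ by simp [add_tmul, Finset.sum_add_distrib]
      map_smul' := fun c w ↦ by simp [smul_tmul, Finset.smul_sum] }
  refine ⟨i, p, linearMap_ext fun e v ↦ ?_⟩
  change ∑ j, tmul S (MulOpposite.op (v j) • e) (Pi.single j 1) = tmul S e v
  simp only [op_smul_tmul]
  simp only [← mk_apply, ← map_sum]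
  refine congrArg (mk S E (Fin r → S) e) ?_
  ext j
  simp [Finset.sum_apply, Pi.single_apply]

instance finite_pi [Module.Finite C E] (r : ℕ) :
    Module.Finite C (BalancedTensor S E (Fin r → S)) := by
  obtain ⟨i, p, h⟩ := exists_retract_of_pi C S E r
  exact Module.Finite.of_surjective p fun x ↦ ⟨i x, LinearMap.congr_fun h x⟩

instance projective_pi [Module.Projective C E] (r : ℕ) :
    Module.Projective C (BalancedTensor S E (Fin r → S)) := by
  obtain ⟨i, p, h⟩ := exists_retract_of_pi C S E r
  have : Module.Projective C (Fin r → E) :=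
    .of_equiv (DFinsupp.linearEquivFunOnFintype (M := fun _ ↦ E))
  exact Module.Projective.of_split i p h

instance finite [Module.Finite C E] [Module.Finite S Y] :
    Module.Finite C (BalancedTensor S E Y) := by
  obtain ⟨r, f, hf⟩ := Module.Finite.exists_fin' S Y
  exact Module.Finite.of_surjective _ (lTensor_surjective (C := C) (E := E) hf)

instance projective [Module.Projective C E] [Module.Finite S Y] [Module.Projective S Y] :
    Module.Projective C (BalancedTensor S E Y) := by
  obtain ⟨r, i, p, h⟩ := exists_retract_of_finite_projective (R := S) Y
  exact Module.Projective.of_split (lTensor C E i) (lTensor C E p)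
    (by rw [← lTensor_comp, h, lTensor_id])

variable (C E) in
theorem _root_.FactorsThroughFree.lTensor [Module.Finite C E] [Module.Projective C E]
    {f : Y →ₗ[S] Y'} (hf : FactorsThroughFree f) :
    FactorsThroughFree (BalancedTensor.lTensor C E f) := by
  obtain ⟨r, α, β, rfl⟩ := hf
  rw [lTensor_comp]
  exact .of_projective _ _

variable (C E) in
theorem _root_.StableIso.lTensor [Module.Finite C E] [Module.Projective C E]
    (h : StableIso S Y Y') : StableIso C (BalancedTensor S E Y) (BalancedTensor S E Y') := by
  obtain ⟨f, g, h₁, h₂⟩ := h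
  refine ⟨BalancedTensor.lTensor C E f, BalancedTensor.lTensor C E g, ?_, ?_⟩
  · simpa only [lTensor_sub, lTensor_comp, lTensor_id] using h₁.lTensor C E
  · simpa only [lTensor_sub, lTensor_comp, lTensor_id] using h₂.lTensor C E

end Exactness

end BalancedTensor

/-- Tensoring with a bimodule that is finite projective on both sides commutes with syzygies up
to stable isomorphism. -/
theorem IsSyzygy.stableIso_balancedTensor {S : Type u} {C : Type*} [Ring S] [Ring C]
    [IsNoetherianRing S] [IsNoetherianRing C] {E : Type*} [AddCommGroup E] [Module Sᵐᵒᵖ E]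
    [Module C E] [SMulCommClass C Sᵐᵒᵖ E] [Module.Finite C E] [Module.Projective C E]
    [Module.Finite Sᵐᵒᵖ E] [Module.Projective Sᵐᵒᵖ E]
    {X : Type*} [AddCommGroup X] [Module S X] [Module.Finite S X]
    {X' : Type*} [AddCommGroup X'] [Module C X'] [Module.Finite C X'] {n : ℕ}
    {Z : ModuleCat S} {Z' : ModuleCat C} (h : IsSyzygy S X n Z) (h' : IsSyzygy C X' n Z')
    (hX : StableIso C (BalancedTensor S E X) X') : StableIso C (BalancedTensor S E Z) Z' := by
  induction n generalizing Z Z' with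
  | zero =>
    obtain ⟨e⟩ := h
    obtain ⟨e'⟩ := h'
    exact (StableIso.of_equiv (BalancedTensor.lCongr C E e)).trans
      (hX.trans (.of_equiv e'.symm))
  | succ n ih =>
    obtain ⟨K, P, hK, _, _, i, p, hi, hip, hp⟩ := h.exists_exact
    obtain ⟨K', P', hK', _, _, i', p', hi', hip', hp'⟩ := h'.exists_exact
    -- Right projectivity of `E` keeps the sequence exact and left projectivity makes `E ⊗_S P`
    -- projective, so both rows are projective presentations of stably isomorphic modules.
    exact StableIso.of_exact (BalancedTensor.lTensor_injective hi) (BalancedTensor.lTensor_exact hip)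
      (BalancedTensor.lTensor_surjective hp) hi' hip' hp' (ih hK hK')

/-! ### Bimodules as modules over `C ⊗[k] Sᵐᵒᵖ` -/

/-- A left module over `C ⊗[k] Sᵐᵒᵖ`, with its separate left action of `C` and right action
of `S`. -/
@[nolint unusedArguments]
def AsBimodule (k C S E : Type*) [Field k] [Ring C] [Algebra k C] [Ring S] [Algebra k S]
    [AddCommGroup E] [Module (C ⊗[k] Sᵐᵒᵖ) E] : Type _ := E

namespace AsBimodule

variable {k C S E E' E'' : Type*} [Field k] [Ring C] [Algebra k C] [Ring S] [Algebra k S]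
  [AddCommGroup E] [Module (C ⊗[k] Sᵐᵒᵖ) E] [AddCommGroup E'] [Module (C ⊗[k] Sᵐᵒᵖ) E']
  [AddCommGroup E''] [Module (C ⊗[k] Sᵐᵒᵖ) E'']

instance : AddCommGroup (AsBimodule k C S E) := inferInstanceAs (AddCommGroup E)

instance : Module (C ⊗[k] Sᵐᵒᵖ) (AsBimodule k C S E) := inferInstanceAs (Module (C ⊗[k] Sᵐᵒᵖ) E)

instance : Module C (AsBimodule k C S E) :=
  Module.compHom E (Algebra.TensorProduct.includeLeft : C →ₐ[k] C ⊗[k] Sᵐᵒᵖ).toRingHom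

instance : Module Sᵐᵒᵖ (AsBimodule k C S E) :=
  Module.compHom E (Algebra.TensorProduct.includeRight : Sᵐᵒᵖ →ₐ[k] C ⊗[k] Sᵐᵒᵖ).toRingHom

theorem left_smul_def (c : C) (e : AsBimodule k C S E) :
    c • e = (c ⊗ₜ[k] (1 : Sᵐᵒᵖ) : C ⊗[k] Sᵐᵒᵖ) • e := rfl

theorem right_smul_def (s : Sᵐᵒᵖ) (e : AsBimodule k C S E) :
    s • e = ((1 : C) ⊗ₜ[k] s : C ⊗[k] Sᵐᵒᵖ) • e := rfl

instance : SMulCommClass C Sᵐᵒᵖ (AsBimodule k C S E) where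
  smul_comm c s e := by
    simp only [left_smul_def, right_smul_def, ← mul_smul, Algebra.TensorProduct.tmul_mul_tmul,
      one_mul, mul_one]

/-- A homomorphism of bimodules as a homomorphism of right modules. -/
def rightHom (f : E →ₗ[C ⊗[k] Sᵐᵒᵖ] E') : AsBimodule k C S E →ₗ[Sᵐᵒᵖ] AsBimodule k C S E' where
  toFun := f
  map_add' := f.map_add
  map_smul' _ e := f.map_smul _ e

variable (Y : Type*) [AddCommGroup Y] [Module S Y]

/-- The functor `- ⊗_S Y` on homomorphisms of `C ⊗[k] Sᵐᵒᵖ`-modules. -/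
def tensorHom (f : E →ₗ[C ⊗[k] Sᵐᵒᵖ] E') :
    BalancedTensor S (AsBimodule k C S E) Y →ₗ[C] BalancedTensor S (AsBimodule k C S E') Y :=
  BalancedTensor.rTensor C Y (rightHom f) fun _ e ↦ f.map_smul _ e

theorem tensorHom_tmul (f : E →ₗ[C ⊗[k] Sᵐᵒᵖ] E') (e : AsBimodule k C S E) (y : Y) :
    tensorHom Y f (BalancedTensor.tmul S e y) =
      BalancedTensor.tmul S (rightHom f e) y := rfl

theorem tensorHom_comp (f : E →ₗ[C ⊗[k] Sᵐᵒᵖ] E') (g : E' →ₗ[C ⊗[k] Sᵐᵒᵖ] E'') :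
    tensorHom Y (g ∘ₗ f) = tensorHom Y g ∘ₗ tensorHom Y f :=
  BalancedTensor.linearMap_ext fun _ _ ↦ rfl

theorem tensorHom_id : tensorHom Y (LinearMap.id : E →ₗ[C ⊗[k] Sᵐᵒᵖ] E) = LinearMap.id :=
  BalancedTensor.linearMap_ext fun _ _ ↦ rfl

theorem tensorHom_sub (f g : E →ₗ[C ⊗[k] Sᵐᵒᵖ] E') :
    tensorHom Y (f - g) = tensorHom Y f - tensorHom Y g :=
  BalancedTensor.linearMap_ext fun e y ↦
    DFunLike.congr_fun (map_sub (BalancedTensor.mk S (AsBimodule k C S E') Y)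
      (rightHom f e) (rightHom g e)) y

/-- The isomorphism `E ⊗_S Y ≃ E' ⊗_S Y` induced by `E ≃ E'`. -/
def tensorCongr (f : E ≃ₗ[C ⊗[k] Sᵐᵒᵖ] E') :
    BalancedTensor S (AsBimodule k C S E) Y ≃ₗ[C] BalancedTensor S (AsBimodule k C S E') Y :=
  .ofLinearMap (tensorHom Y f.toLinearMap) (tensorHom Y f.symm.toLinearMap)
    (by rw [← tensorHom_comp, f.comp_symm, tensorHom_id])
    (by rw [← tensorHom_comp, f.symm_comp, tensorHom_id])

/-- A retraction from a free bimodule survives the additive functor `- ⊗_S Y`. The target is a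
direct sum `Π₀` since projectivity passes to direct sums. -/
theorem exists_retract_tensor [Module.Finite (C ⊗[k] Sᵐᵒᵖ) E]
    [Module.Projective (C ⊗[k] Sᵐᵒᵖ) E] :
    ∃ (r : ℕ) (i : BalancedTensor S (AsBimodule k C S E) Y →ₗ[C]
        Π₀ _ : Fin r, BalancedTensor S (AsBimodule k C S (C ⊗[k] Sᵐᵒᵖ)) Y)
      (p : (Π₀ _ : Fin r, BalancedTensor S (AsBimodule k C S (C ⊗[k] Sᵐᵒᵖ)) Y) →ₗ[C]
        BalancedTensor S (AsBimodule k C S E) Y), p ∘ₗ i = LinearMap.id := by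
  obtain ⟨r, i, p, h⟩ := exists_retract_of_finite_projective (R := C ⊗[k] Sᵐᵒᵖ) E
  refine ⟨r, DFinsupp.linearEquivFunOnFintype.symm.toLinearMap ∘ₗ
    LinearMap.pi fun j ↦ tensorHom Y (LinearMap.proj j ∘ₗ i),
    LinearMap.lsum C (fun _ : Fin r ↦ BalancedTensor S (AsBimodule k C S (C ⊗[k] Sᵐᵒᵖ)) Y) ℕ
      (fun j ↦ tensorHom Y (p ∘ₗ LinearMap.single (C ⊗[k] Sᵐᵒᵖ) (fun _ ↦ C ⊗[k] Sᵐᵒᵖ) j)) ∘ₗ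
      DFinsupp.linearEquivFunOnFintype.toLinearMap, BalancedTensor.linearMap_ext fun e y ↦ ?_⟩
  simp only [LinearMap.comp_apply, LinearEquiv.coe_coe, LinearEquiv.apply_symm_apply,
    LinearMap.lsum_apply, LinearMap.sum_apply, LinearMap.pi_apply, LinearMap.proj_apply,
    tensorHom_tmul, LinearMap.id_apply]
  rw [← BalancedTensor.sum_tmul]
  refine congrArg (BalancedTensor.tmul S · y) ?_
  change ∑ j, p (Pi.single j (i e j)) = (e : E)
  rw [← map_sum, Finset.univ_sum_single]
  exact LinearMap.congr_fun h e

-- Tensoring projective bimodules with a finite-dimensional module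

section FiniteProjective

variable [Module k Y] [IsScalarTower k S Y]

-- The maps are `(c ⊗ s) ⊗ y ↦ c ⊗ s y` and `c ⊗ y ↦ (c ⊗ 1) ⊗ y`. The point is that `C ⊗[k] Y` is
-- free over `C`, because `k` is a field.
variable (k C S) in
theorem exists_retract_of_self :
    ∃ (i : BalancedTensor S (AsBimodule k C S (C ⊗[k] Sᵐᵒᵖ)) Y →ₗ[C] C ⊗[k] Y)
      (p : C ⊗[k] Y →ₗ[C] BalancedTensor S (AsBimodule k C S (C ⊗[k] Sᵐᵒᵖ)) Y),
      p ∘ₗ i = LinearMap.id := by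
  let h : Y →ₗ[k] Sᵐᵒᵖ →ₗ[k] Y := ((Algebra.lsmul k k Y).toLinearMap ∘ₗ
    (MulOpposite.opLinearEquiv k : S ≃ₗ[k] Sᵐᵒᵖ).symm.toLinearMap).flip
  let φ : AsBimodule k C S (C ⊗[k] Sᵐᵒᵖ) →+ Y →+ C ⊗[k] Y :=
    (AddMonoidHom.mk' (fun y ↦ (LinearMap.lTensor C (h y)).toAddMonoidHom) fun y y' ↦ by
      ext t
      simp).flip
  have hφ (c : C) (s : Sᵐᵒᵖ) (y : Y) : φ (c ⊗ₜ[k] s : C ⊗[k] Sᵐᵒᵖ) y = c ⊗ₜ[k] (s.unop • y) := rfl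
  let i : BalancedTensor S (AsBimodule k C S (C ⊗[k] Sᵐᵒᵖ)) Y →ₗ[C] C ⊗[k] Y :=
    BalancedTensor.toLinearMap (BalancedTensor.lift φ fun e s y ↦ by
      change C ⊗[k] Sᵐᵒᵖ at e
      change φ ((1 ⊗ₜ[k] MulOpposite.op s : C ⊗[k] Sᵐᵒᵖ) • e : C ⊗[k] Sᵐᵒᵖ) y = _
      induction e using TensorProduct.induction_on with
      | zero => rw [smul_zero]; erw [map_zero]; simp
      | tmul c t =>
        rw [smul_eq_mul, Algebra.TensorProduct.tmul_mul_tmul, hφ, hφ, one_mul, MulOpposite.unop_mul,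
          mul_smul, MulOpposite.unop_op]
      | add a b ha hb =>
        rw [smul_add]
        erw [map_add, map_add]
        rw [AddMonoidHom.add_apply, AddMonoidHom.add_apply, ha, hb])
      fun c e y ↦ by
        change C ⊗[k] Sᵐᵒᵖ at e
        change φ ((c ⊗ₜ[k] 1 : C ⊗[k] Sᵐᵒᵖ) • e : C ⊗[k] Sᵐᵒᵖ) y = c • φ e y
        induction e using TensorProduct.induction_on with
        | zero => rw [smul_zero]; erw [map_zero]; simp
        | tmul d t =>
          rw [smul_eq_mul, Algebra.TensorProduct.tmul_mul_tmul, hφ, hφ, one_mul,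
            TensorProduct.smul_tmul', smul_eq_mul]
        | add a b ha hb =>
          rw [smul_add]
          erw [map_add, map_add]
          rw [AddMonoidHom.add_apply, AddMonoidHom.add_apply, ha, hb, smul_add]
  let q : C ⊗[k] Y →+ BalancedTensor S (AsBimodule k C S (C ⊗[k] Sᵐᵒᵖ)) Y :=
    TensorProduct.liftAddHom ((BalancedTensor.mk S (AsBimodule k C S (C ⊗[k] Sᵐᵒᵖ)) Y).comp
      (Algebra.TensorProduct.includeLeft : C →ₐ[k] C ⊗[k] Sᵐᵒᵖ).toAddMonoidHom) fun r c y ↦ by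
      change BalancedTensor.tmul S (E := AsBimodule k C S (C ⊗[k] Sᵐᵒᵖ))
        ((r • c) ⊗ₜ[k] 1 : C ⊗[k] Sᵐᵒᵖ) y = BalancedTensor.tmul S
        (E := AsBimodule k C S (C ⊗[k] Sᵐᵒᵖ)) (c ⊗ₜ[k] 1 : C ⊗[k] Sᵐᵒᵖ) (r • y)
      -- A scalar of `k` crosses the tensor sign over `S` as the element `algebraMap k S r`.
      rw [← algebraMap_smul S r y]
      refine Eq.trans (congrArg (BalancedTensor.tmul S · y) ?_) (BalancedTensor.op_smul_tmul
        (E := AsBimodule k C S (C ⊗[k] Sᵐᵒᵖ)) (c ⊗ₜ[k] 1 : C ⊗[k] Sᵐᵒᵖ) (algebraMap k S r) y)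
      change _ = ((1 : C) ⊗ₜ[k] MulOpposite.op (algebraMap k S r) : C ⊗[k] Sᵐᵒᵖ) *
        (c ⊗ₜ[k] 1 : C ⊗[k] Sᵐᵒᵖ)
      rw [Algebra.TensorProduct.tmul_mul_tmul, one_mul, mul_one, TensorProduct.smul_tmul,
        Algebra.algebraMap_eq_smul_one, MulOpposite.op_smul, MulOpposite.op_one]
  let p : C ⊗[k] Y →ₗ[C] BalancedTensor S (AsBimodule k C S (C ⊗[k] Sᵐᵒᵖ)) Y :=
    { q with
      map_smul' := fun c t ↦ by
        change q (c • t) = c • q t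
        induction t using TensorProduct.induction_on with
        | zero => rw [smul_zero, map_zero, smul_zero]
        | add s t hs ht => rw [smul_add, map_add, map_add, smul_add, hs, ht]
        | tmul d y =>
          change BalancedTensor.tmul S (E := AsBimodule k C S (C ⊗[k] Sᵐᵒᵖ))
            ((c * d) ⊗ₜ[k] 1 : C ⊗[k] Sᵐᵒᵖ) y = BalancedTensor.tmul S
            (E := AsBimodule k C S (C ⊗[k] Sᵐᵒᵖ))
              ((c ⊗ₜ[k] 1 : C ⊗[k] Sᵐᵒᵖ) * (d ⊗ₜ[k] 1 : C ⊗[k] Sᵐᵒᵖ)) y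
          rw [Algebra.TensorProduct.tmul_mul_tmul, one_mul] }
  refine ⟨i, p, BalancedTensor.linearMap_ext fun e y ↦ ?_⟩
  change q (φ e y) = BalancedTensor.tmul S e y
  change C ⊗[k] Sᵐᵒᵖ at e
  induction e using TensorProduct.induction_on with
  | zero => erw [map_zero, BalancedTensor.zero_tmul]
  | add a b ha hb =>
    erw [map_add, BalancedTensor.add_tmul]
    rw [AddMonoidHom.add_apply, map_add, ha, hb]
  | tmul c s =>
    rw [hφ]
    refine Eq.trans (BalancedTensor.op_smul_tmul (E := AsBimodule k C S (C ⊗[k] Sᵐᵒᵖ))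
      (c ⊗ₜ[k] 1 : C ⊗[k] Sᵐᵒᵖ) s.unop y).symm (congrArg (BalancedTensor.tmul S · y) ?_)
    change ((1 : C) ⊗ₜ[k] s : C ⊗[k] Sᵐᵒᵖ) * (c ⊗ₜ[k] 1 : C ⊗[k] Sᵐᵒᵖ) = _
    rw [Algebra.TensorProduct.tmul_mul_tmul, one_mul, mul_one]

variable (k C S) in
theorem finite_projective_tensor_self [Module.Finite k Y] :
    Module.Finite C (BalancedTensor S (AsBimodule k C S (C ⊗[k] Sᵐᵒᵖ)) Y) ∧
      Module.Projective C (BalancedTensor S (AsBimodule k C S (C ⊗[k] Sᵐᵒᵖ)) Y) := by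
  obtain ⟨i, p, h⟩ := exists_retract_of_self k C S Y
  exact ⟨.of_surjective p fun x ↦ ⟨i x, LinearMap.congr_fun h x⟩, .of_split i p h⟩

theorem finite_tensor [Module.Finite k Y] [Module.Finite (C ⊗[k] Sᵐᵒᵖ) E]
    [Module.Projective (C ⊗[k] Sᵐᵒᵖ) E] :
    Module.Finite C (BalancedTensor S (AsBimodule k C S E) Y) := by
  obtain ⟨r, i, p, h⟩ := exists_retract_tensor (E := E) (k := k) (C := C) (S := S) Y
  have := (finite_projective_tensor_self k C S Y).1
  exact .of_surjective p fun x ↦ ⟨i x, LinearMap.congr_fun h x⟩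

theorem projective_tensor [Module.Finite k Y] [Module.Finite (C ⊗[k] Sᵐᵒᵖ) E]
    [Module.Projective (C ⊗[k] Sᵐᵒᵖ) E] :
    Module.Projective C (BalancedTensor S (AsBimodule k C S E) Y) := by
  obtain ⟨r, i, p, h⟩ := exists_retract_tensor (E := E) (k := k) (C := C) (S := S) Y
  have := (finite_projective_tensor_self k C S Y).2
  exact .of_split i p h

/-- Projective bimodules become projective left modules even when `Y` is not projective, so `- ⊗_S
Y` descends to stable categories. -/
theorem _root_.FactorsThroughFree.tensorHom [Module.Finite k Y] {f : E →ₗ[C ⊗[k] Sᵐᵒᵖ] E'}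
    (hf : FactorsThroughFree f) : FactorsThroughFree (AsBimodule.tensorHom Y f) := by
  obtain ⟨r, α, β, rfl⟩ := hf
  have := finite_tensor (E := Fin r → C ⊗[k] Sᵐᵒᵖ) (k := k) (C := C) (S := S) Y
  have := projective_tensor (E := Fin r → C ⊗[k] Sᵐᵒᵖ) (k := k) (C := C) (S := S) Y
  rw [tensorHom_comp]
  exact .of_projective _ _

theorem _root_.StableIso.tensorHom [Module.Finite k Y] (h : StableIso (C ⊗[k] Sᵐᵒᵖ) E E') :
    StableIso C (BalancedTensor S (AsBimodule k C S E) Y)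
      (BalancedTensor S (AsBimodule k C S E') Y) := by
  obtain ⟨f, g, h₁, h₂⟩ := h
  refine ⟨AsBimodule.tensorHom Y f, AsBimodule.tensorHom Y g, ?_, ?_⟩
  · simpa only [tensorHom_sub, tensorHom_comp, tensorHom_id] using h₁.tensorHom Y
  · simpa only [tensorHom_sub, tensorHom_comp, tensorHom_id] using h₂.tensorHom Y

end FiniteProjective

end AsBimodule

-- Right projective bimodules and exactness of `- ⊗_S Y`

namespace AsBimodule

section RightProjective

variable {k C S E E' K P : Type*} [Field k] [Ring C] [Algebra k C] [Ring S] [Algebra k S]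
  [AddCommGroup E] [Module (C ⊗[k] Sᵐᵒᵖ) E] [AddCommGroup E'] [Module (C ⊗[k] Sᵐᵒᵖ) E']
  [AddCommGroup K] [Module (C ⊗[k] Sᵐᵒᵖ) K] [AddCommGroup P] [Module (C ⊗[k] Sᵐᵒᵖ) P]

variable (k C S) in
/-- The finite free bimodules as right modules. -/
def rightEquivOfPi (r : ℕ) :
    AsBimodule k C S (Fin r → C ⊗[k] Sᵐᵒᵖ) ≃ₗ[Sᵐᵒᵖ] (Fin r → Sᵐᵒᵖ ⊗[k] C) :=
  { (AddEquiv.piCongrRight fun _ : Fin r ↦ (TensorProduct.comm k C Sᵐᵒᵖ).toAddEquiv) with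
    map_smul' := fun s v ↦ by
      ext j
      change TensorProduct.comm k C Sᵐᵒᵖ (((1 : C) ⊗ₜ[k] s : C ⊗[k] Sᵐᵒᵖ) * v j) =
        s • TensorProduct.comm k C Sᵐᵒᵖ (v j)
      generalize (v j : C ⊗[k] Sᵐᵒᵖ) = t
      induction t using TensorProduct.induction_on with
      | zero => simp
      | tmul c t =>
        rw [Algebra.TensorProduct.tmul_mul_tmul, one_mul, TensorProduct.comm_tmul,
          TensorProduct.comm_tmul, TensorProduct.smul_tmul', smul_eq_mul]
      | add a b ha hb => rw [mul_add, map_add, map_add, smul_add, ha, hb] }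

/-- As a right module, a free bimodule is a power of `Sᵐᵒᵖ ⊗[k] C`, a base change from the field
`k`. -/
theorem projective_right [Module.Finite (C ⊗[k] Sᵐᵒᵖ) P] [Module.Projective (C ⊗[k] Sᵐᵒᵖ) P] :
    Module.Projective Sᵐᵒᵖ (AsBimodule k C S P) := by
  obtain ⟨r, i, p, h⟩ := exists_retract_of_finite_projective (R := C ⊗[k] Sᵐᵒᵖ) P
  have : Module.Projective Sᵐᵒᵖ (AsBimodule k C S (Fin r → C ⊗[k] Sᵐᵒᵖ)) :=
    .of_equiv (rightEquivOfPi k C S r).symm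
  exact .of_split (rightHom i) (rightHom p) (LinearMap.ext fun x ↦ LinearMap.congr_fun h x)

/-- A right-linear section `s` of `p` exists because `E` is right projective, and `q` is `1 - s p`
read in `K`. Neither map need be `C`-linear. -/
theorem exists_right_splitting [Module.Projective Sᵐᵒᵖ (AsBimodule k C S E)]
    {i : K →ₗ[C ⊗[k] Sᵐᵒᵖ] P} {p : P →ₗ[C ⊗[k] Sᵐᵒᵖ] E} (hi : Function.Injective i)
    (h : Function.Exact i p) (hp : Function.Surjective p) :
    ∃ (s : AsBimodule k C S E →ₗ[Sᵐᵒᵖ] AsBimodule k C S P)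
      (q : AsBimodule k C S P →ₗ[Sᵐᵒᵖ] AsBimodule k C S K),
      rightHom p ∘ₗ s = LinearMap.id ∧ q ∘ₗ rightHom i = LinearMap.id ∧
        rightHom i ∘ₗ q + s ∘ₗ rightHom p = LinearMap.id := by
  have hi' : Function.Injective (rightHom i) := hi
  obtain ⟨s, hs⟩ := Module.projective_lifting_property (rightHom p) LinearMap.id hp
  have hr : ∀ x, (LinearMap.id - s ∘ₗ rightHom p :
      AsBimodule k C S P →ₗ[Sᵐᵒᵖ] AsBimodule k C S P) x ∈ LinearMap.range (rightHom i) := fun x ↦ by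
    refine (h _).1 ?_
    change rightHom p (x - s (rightHom p x)) = 0
    have := LinearMap.congr_fun hs (rightHom p x)
    rw [LinearMap.comp_apply, LinearMap.id_apply] at this
    rw [map_sub, this, sub_self]
  let q := (LinearEquiv.ofInjective (rightHom i) hi').symm.toLinearMap ∘ₗ
    (LinearMap.id - s ∘ₗ rightHom p).codRestrict _ hr
  have hq : rightHom i ∘ₗ q + s ∘ₗ rightHom p = LinearMap.id := by
    ext x
    have := LinearEquiv.ofInjective_apply (h := hi') (rightHom i) (q x)
    simp only [q, LinearMap.comp_apply, LinearEquiv.coe_coe, LinearEquiv.apply_symm_apply] at this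
    simp [q, ← this]
  refine ⟨s, q, hs, LinearMap.ext fun x ↦ hi' ?_, hq⟩
  have h₁ := LinearMap.congr_fun hq (rightHom i x)
  have h₂ : rightHom p (rightHom i x) = 0 := h.apply_apply_eq_zero x
  simpa [h₂] using h₁

variable (Y : Type*) [AddCommGroup Y] [Module S Y]

/-- A right splitting survives tensoring with `Y`. The induced maps are only additive, but
injectivity, exactness and surjectivity concern only the underlying groups. -/
theorem tensorHom_exact [Module.Projective Sᵐᵒᵖ (AsBimodule k C S E)]
    {i : K →ₗ[C ⊗[k] Sᵐᵒᵖ] P} {p : P →ₗ[C ⊗[k] Sᵐᵒᵖ] E} (hi : Function.Injective i)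
    (h : Function.Exact i p) (hp : Function.Surjective p) :
    Function.Injective (tensorHom Y i) ∧ Function.Exact (tensorHom Y i) (tensorHom Y p) ∧
      Function.Surjective (tensorHom Y p) := by
  obtain ⟨s, q, h₁, h₂, h₃⟩ := exists_right_splitting hi h hp
  have hs (t) : tensorHom Y p (BalancedTensor.map s LinearMap.id t) = t := by
    refine (BalancedTensor.map_comp_apply s .id (rightHom p) .id t).symm.trans ?_
    rw [h₁]
    exact BalancedTensor.map_id_apply t
  have hq (t) : BalancedTensor.map q LinearMap.id (tensorHom Y i t) = t := by
    refine (BalancedTensor.map_comp_apply (rightHom i) .id q .id t).symm.trans ?_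
    rw [h₂]
    exact BalancedTensor.map_id_apply t
  have hsq (t) : tensorHom Y i (BalancedTensor.map q LinearMap.id t) +
      BalancedTensor.map s LinearMap.id (tensorHom Y p t) = t := by
    refine (congrArg₂ (· + ·) (BalancedTensor.map_comp_apply q .id (rightHom i) .id t)
      (BalancedTensor.map_comp_apply (rightHom p) .id s .id t)).symm.trans ?_
    refine (BalancedTensor.map_add_left_apply _ _ _ t).symm.trans ?_
    rw [h₃]
    exact BalancedTensor.map_id_apply t
  refine ⟨Function.LeftInverse.injective hq, fun t ↦ ⟨fun ht ↦ ?_, ?_⟩,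
    Function.RightInverse.surjective hs⟩
  · have := hsq t
    rw [ht, map_zero, add_zero] at this
    exact ⟨_, this⟩
  · rintro ⟨t, rfl⟩
    rw [← LinearMap.comp_apply, ← tensorHom_comp, h.linearMap_comp_eq_zero]
    have := tensorHom_sub Y (0 : K →ₗ[C ⊗[k] Sᵐᵒᵖ] E) 0
    rw [sub_self, sub_self] at this
    rw [this, LinearMap.zero_apply]

end RightProjective

/-- Tensoring a syzygy of a right projective bimodule with a module gives a syzygy of the tensor
product, up to stable isomorphism. -/
theorem _root_.IsSyzygy.stableIso_tensor {k : Type*} {C S : Type u} [Field k] [Ring C]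
    [Algebra k C] [Ring S] [Algebra k S] [IsNoetherianRing (C ⊗[k] Sᵐᵒᵖ)] [IsNoetherianRing C]
    {E : Type*} [AddCommGroup E] [Module (C ⊗[k] Sᵐᵒᵖ) E] [Module.Finite (C ⊗[k] Sᵐᵒᵖ) E]
    [Module.Projective Sᵐᵒᵖ (AsBimodule k C S E)]
    {Y : Type*} [AddCommGroup Y] [Module S Y] [Module k Y] [IsScalarTower k S Y]
    [Module.Finite k Y] {X' : Type*} [AddCommGroup X'] [Module C X'] [Module.Finite C X']
    {n : ℕ} {Z : ModuleCat.{u} (C ⊗[k] Sᵐᵒᵖ)} {Z' : ModuleCat.{u} C}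
    (h : IsSyzygy (C ⊗[k] Sᵐᵒᵖ) E n Z) (h' : IsSyzygy C X' n Z')
    (hX : StableIso C (BalancedTensor S (AsBimodule k C S E) Y) X') :
    Module.Projective Sᵐᵒᵖ (AsBimodule k C S Z) ∧
      StableIso C (BalancedTensor S (AsBimodule k C S Z) Y) Z' := by
  induction n generalizing Z Z' with
  | zero =>
    obtain ⟨e⟩ := h
    obtain ⟨e'⟩ := h'
    refine ⟨.of_split (rightHom e.toLinearMap) (rightHom e.symm.toLinearMap)
      (LinearMap.ext fun x ↦ e.symm_apply_apply x), ?_⟩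
    exact (StableIso.of_equiv (tensorCongr Y e)).trans (hX.trans (.of_equiv e'.symm))
  | succ n ih =>
    obtain ⟨K, P, hK, _, _, i, p, hi, hip, hp⟩ := h.exists_exact
    obtain ⟨K', P', hK', _, _, i', p', hi', hip', hp'⟩ := h'.exists_exact
    -- Right projectivity is carried through the induction: that of `K` splits the sequence on the
    -- right, which makes `Z` a right summand of the right projective module `P`.
    obtain ⟨_, ih⟩ := ih hK hK'
    obtain ⟨s, q, -, hq, -⟩ := exists_right_splitting hi hip hp
    have := projective_right (k := k) (C := C) (S := S) (P := P)
    refine ⟨.of_split _ q hq, ?_⟩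
    obtain ⟨h₁, h₂, h₃⟩ := tensorHom_exact Y hi hip hp
    have := finite_tensor (k := k) (C := C) (S := S) (E := P) Y
    have := projective_tensor (k := k) (C := C) (S := S) (E := P) Y
    exact StableIso.of_exact h₁ h₂ h₃ hi' hip' hp' ih

/-! ### The regular bimodule -/

section Regular

attribute [local instance] TensorProduct.Algebra.module

variable (k S : Type*) [Field k] [Ring S] [Algebra k S]

/-- The underlying additive group of the regular bimodule. -/
def regularAddEquiv : AsBimodule k S S S ≃+ S := AddEquiv.refl S

theorem regularAddEquiv_left_smul (c : S) (x : AsBimodule k S S S) :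
    regularAddEquiv k S (c • x) = c * regularAddEquiv k S x := by
  refine (TensorProduct.Algebra.smul_def (R := k) c (1 : Sᵐᵒᵖ) (regularAddEquiv k S x)).trans ?_
  rw [one_smul, smul_eq_mul]

theorem regularAddEquiv_right_smul (s : Sᵐᵒᵖ) (x : AsBimodule k S S S) :
    regularAddEquiv k S (s • x) = regularAddEquiv k S x * s.unop := by
  refine (TensorProduct.Algebra.smul_def (R := k) (1 : S) s (regularAddEquiv k S x)).trans ?_
  rw [one_smul, MulOpposite.smul_eq_mul_unop]

instance finite_regular : Module.Finite (S ⊗[k] Sᵐᵒᵖ) S :=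
  .of_surjective (LinearMap.toSpanSingleton (S ⊗[k] Sᵐᵒᵖ) S 1) fun s ↦
    ⟨s ⊗ₜ 1, by rw [LinearMap.toSpanSingleton_apply, TensorProduct.Algebra.smul_def, one_smul,
      smul_eq_mul, mul_one]⟩

/-- The regular bimodule is free of rank one as a right module. -/
def regularRightEquiv : AsBimodule k S S S ≃ₗ[Sᵐᵒᵖ] Sᵐᵒᵖ where
  __ := (regularAddEquiv k S).trans MulOpposite.opAddEquiv
  map_smul' s x := congrArg MulOpposite.op (regularAddEquiv_right_smul k S s x)

instance projective_right_regular : Module.Projective Sᵐᵒᵖ (AsBimodule k S S S) :=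
  .of_equiv (regularRightEquiv k S).symm

variable (Y : Type*) [AddCommGroup Y] [Module S Y]

/-- The action map `S ⊗_S Y → Y`. -/
def regularTensorHom : BalancedTensor S (AsBimodule k S S S) Y →ₗ[S] Y :=
  BalancedTensor.toLinearMap
    (BalancedTensor.lift ((AddMonoidHom.mk' (fun s : S ↦ DistribSMul.toAddMonoidHom Y s)
      fun s t ↦ AddMonoidHom.ext (add_smul s t)).comp (regularAddEquiv k S).toAddMonoidHom)
      fun e s y ↦ by
        change regularAddEquiv k S (MulOpposite.op s • e) • y = regularAddEquiv k S e • s • y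
        rw [regularAddEquiv_right_smul, mul_smul, MulOpposite.unop_op])
    fun c e y ↦ by
      change regularAddEquiv k S (c • e) • y = c • regularAddEquiv k S e • y
      rw [regularAddEquiv_left_smul, mul_smul]

theorem smul_regularAddEquiv_symm_one (s : S) :
    s • (regularAddEquiv k S).symm 1 = (regularAddEquiv k S).symm s := by
  apply (regularAddEquiv k S).injective
  rw [regularAddEquiv_left_smul, AddEquiv.apply_symm_apply, AddEquiv.apply_symm_apply, mul_one]

theorem op_smul_regularAddEquiv_symm_one (s : S) :
    MulOpposite.op s • (regularAddEquiv k S).symm 1 = (regularAddEquiv k S).symm s := by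
  apply (regularAddEquiv k S).injective
  rw [regularAddEquiv_right_smul, AddEquiv.apply_symm_apply, AddEquiv.apply_symm_apply, one_mul,
    MulOpposite.unop_op]

/-- The isomorphism `S ⊗_S Y ≃ Y`. -/
def regularTensorEquiv : BalancedTensor S (AsBimodule k S S S) Y ≃ₗ[S] Y :=
  .ofLinearMap (regularTensorHom k S Y)
    { toFun := fun y ↦ BalancedTensor.tmul S ((regularAddEquiv k S).symm 1) y
      map_add' := BalancedTensor.tmul_add _
      map_smul' := fun s y ↦ by
        rw [← BalancedTensor.op_smul_tmul, RingHom.id_apply, BalancedTensor.smul_tmul,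
          op_smul_regularAddEquiv_symm_one, smul_regularAddEquiv_symm_one] }
    (LinearMap.ext fun y ↦ one_smul S y)
    (BalancedTensor.linearMap_ext fun e y ↦ by
      refine (BalancedTensor.op_smul_tmul ((regularAddEquiv k S).symm 1)
        (regularAddEquiv k S e) y).symm.trans ?_
      rw [op_smul_regularAddEquiv_symm_one, AddEquiv.symm_apply_apply]
      rfl)

end Regular

end AsBimodule

/-! ### Associativity of the tensor product -/

section Associativity

attribute [local instance] outerModule

variable {k C A S N M : Type*} [Field k] [Ring C] [Algebra k C] [Ring A]
  [Ring S] [Algebra k S]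
  [AddCommGroup N] [Module k N] [Module C N] [Module Aᵐᵒᵖ N]
  [IsScalarTower k C N] [SMulCommClass C Aᵐᵒᵖ N]
  [AddCommGroup M] [Module k M] [Module A M] [Module Sᵐᵒᵖ M]
  [IsScalarTower k Sᵐᵒᵖ M] [SMulCommClass A Sᵐᵒᵖ M]

namespace BimoduleTensor

variable (k C A S N M) in
/-- The biadditive map to the tensor product of bimodules. -/
noncomputable def mk : N →+ M →+ AsBimodule k C S (BimoduleTensor k C A S N M) :=
  AddMonoidHom.mk' (fun n ↦ AddMonoidHom.mk'
      (fun m ↦ (Submodule.Quotient.mk (n ⊗ₜ[k] m) : BimoduleTensor k C A S N M))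
      fun m m' ↦ by rw [TensorProduct.tmul_add, Submodule.Quotient.mk_add]; rfl)
    fun n n' ↦ AddMonoidHom.ext fun m ↦
      congrArg (Submodule.Quotient.mk (p := balancedRelations k C A S N M))
        (TensorProduct.add_tmul n n' m)

theorem left_smul_mk (c : C) (n : N) (m : M) :
    c • mk k C A S N M n m = mk k C A S N M (c • n) m := by
  refine congrArg (Submodule.Quotient.mk (p := balancedRelations k C A S N M))
    ((outer_smul_tmul k C S N M c 1 n m).trans ?_)
  rw [one_smul]

theorem right_smul_mk (s : Sᵐᵒᵖ) (n : N) (m : M) :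
    s • mk k C A S N M n m = mk k C A S N M n (s • m) := by
  refine congrArg (Submodule.Quotient.mk (p := balancedRelations k C A S N M))
    ((outer_smul_tmul k C S N M 1 s n m).trans ?_)
  rw [one_smul]

theorem mk_op_smul (n : N) (a : A) (m : M) :
    mk k C A S N M (MulOpposite.op a • n) m = mk k C A S N M n (a • m) :=
  (Submodule.Quotient.eq (balancedRelations k C A S N M)).2
    (Submodule.subset_span ⟨n, a, m, rfl⟩)

@[elab_as_elim]
theorem induction {p : AsBimodule k C S (BimoduleTensor k C A S N M) → Prop}
    (t : AsBimodule k C S (BimoduleTensor k C A S N M)) (zero : p 0)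
    (tmul : ∀ n m, p (mk k C A S N M n m)) (add : ∀ s t, p s → p t → p (s + t)) : p t := by
  obtain ⟨t, rfl⟩ := Submodule.Quotient.mk_surjective (balancedRelations k C A S N M) t
  induction t using TensorProduct.induction_on with
  | zero => exact zero
  | tmul n m => exact tmul n m
  | add s t hs ht => exact add _ _ hs ht

variable [Algebra k A] [IsScalarTower k Aᵐᵒᵖ N] [IsScalarTower k A M]

/-- The universal property of the tensor product of bimodules. -/
theorem exists_lift {G : Type*} [AddCommGroup G] (φ : N →+ M →+ G)
    (h : ∀ n (a : A) m, φ (MulOpposite.op a • n) m = φ n (a • m)) :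
    ∃ f : AsBimodule k C S (BimoduleTensor k C A S N M) →+ G,
      ∀ n m, f (mk k C A S N M n m) = φ n m := by
  -- Balancing over `A` implies balancing over `k`, since `k` acts on both factors through
  -- `algebraMap k A`.
  have hk (r : k) (n : N) (m : M) : φ (r • n) m = φ n (r • m) := by
    have : r • n = MulOpposite.op (algebraMap k A r) • n := by
      rw [← algebraMap_smul Aᵐᵒᵖ r n]
      rfl
    rw [this, h, algebraMap_smul]
  let f : N ⊗[k] M →+ G := TensorProduct.liftAddHom φ hk
  -- The relations form a `k`-span while `f` is only additive, so the induction quantifies over a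
  -- scalar `r`, set to `1` at the end.
  have hf (t : N ⊗[k] M) (ht : t ∈ balancedRelations k C A S N M) : ∀ r : k, f (r • t) = 0 := by
    change t ∈ Submodule.span k _ at ht
    induction ht using Submodule.span_induction with
    | zero => intro r; rw [smul_zero, map_zero]
    | add s t _ _ hs ht => intro r; rw [smul_add, map_add, hs, ht, add_zero]
    | smul a t _ ht => intro r; rw [← mul_smul, ht]
    | mem t ht =>
      obtain ⟨n, a, m, rfl⟩ := ht
      intro r
      rw [smul_sub, TensorProduct.smul_tmul', TensorProduct.smul_tmul', map_sub,
        smul_comm r (MulOpposite.op a) n]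
      change φ _ _ - φ _ _ = 0
      rw [h, sub_self]
  exact ⟨QuotientAddGroup.lift (balancedRelations k C A S N M).toAddSubgroup f fun t ht ↦ by
    simpa using hf t ht 1, fun n m ↦ rfl⟩

variable (k C A S N M) in
/-- The associativity isomorphism `(N ⊗_A M) ⊗_S Y ≃ N ⊗_A (M ⊗_S Y)`. -/
theorem nonempty_assoc (Y : Type*) [AddCommGroup Y] [Module S Y] :
    Nonempty (BalancedTensor S (AsBimodule k C S (BimoduleTensor k C A S N M)) Y ≃ₗ[C]
      BalancedTensor A N (BalancedTensor S M Y)) := by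
  let φ : N →+ M →+ Y →+ BalancedTensor A N (BalancedTensor S M Y) :=
    AddMonoidHom.mk' (fun n ↦ AddMonoidHom.mk' (fun m ↦
      (BalancedTensor.mk A N (BalancedTensor S M Y) n).comp (BalancedTensor.mk S M Y m))
      fun m m' ↦ by rw [map_add, AddMonoidHom.comp_add])
      fun n n' ↦ by
        ext m y
        rw [map_add]
        rfl
  obtain ⟨f, hf⟩ := exists_lift (k := k) (C := C) (A := A) (S := S) φ fun n a m ↦
    AddMonoidHom.ext fun y ↦ BalancedTensor.op_smul_tmul n a _
  have hf' (n : N) (m : M) (y : Y) : f (mk k C A S N M n m) y =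
      BalancedTensor.tmul A n (BalancedTensor.tmul S m y) := by rw [hf]; rfl
  let F : BalancedTensor S (AsBimodule k C S (BimoduleTensor k C A S N M)) Y →ₗ[C]
      BalancedTensor A N (BalancedTensor S M Y) :=
    BalancedTensor.toLinearMap (BalancedTensor.lift f fun e s y ↦ by
        induction e using BimoduleTensor.induction with
        | zero => rw [smul_zero, map_zero]; rfl
        | tmul n m => rw [right_smul_mk, hf', hf', BalancedTensor.op_smul_tmul]
        | add a b ha hb =>
          rw [smul_add, map_add, map_add, AddMonoidHom.add_apply, AddMonoidHom.add_apply, ha, hb])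
      fun c e y ↦ by
        rw [BalancedTensor.lift_tmul, BalancedTensor.lift_tmul]
        induction e using BimoduleTensor.induction with
        | zero => rw [smul_zero, map_zero, AddMonoidHom.zero_apply, smul_zero]
        | tmul n m => rw [left_smul_mk, hf', hf', BalancedTensor.smul_tmul]
        | add a b ha hb =>
          rw [smul_add, map_add, map_add, AddMonoidHom.add_apply, AddMonoidHom.add_apply, ha, hb,
            smul_add]
  have hF (n : N) (m : M) (y : Y) : F (BalancedTensor.tmul S (mk k C A S N M n m) y) =
      BalancedTensor.tmul A n (BalancedTensor.tmul S m y) := hf' n m y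
  let ψ (n : N) : BalancedTensor S M Y →+
      BalancedTensor S (AsBimodule k C S (BimoduleTensor k C A S N M)) Y :=
    BalancedTensor.lift ((BalancedTensor.mk S
      (AsBimodule k C S (BimoduleTensor k C A S N M)) Y).comp (mk k C A S N M n)) fun m s y ↦ by
      change BalancedTensor.tmul S (mk k C A S N M n (MulOpposite.op s • m)) y =
        BalancedTensor.tmul S (mk k C A S N M n m) (s • y)
      rw [← right_smul_mk, BalancedTensor.op_smul_tmul]
  have hψ (n : N) (m : M) (y : Y) : ψ n (BalancedTensor.tmul S m y) =
      BalancedTensor.tmul S (mk k C A S N M n m) y := rfl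
  let G : BalancedTensor A N (BalancedTensor S M Y) →+
      BalancedTensor S (AsBimodule k C S (BimoduleTensor k C A S N M)) Y :=
    BalancedTensor.lift (AddMonoidHom.mk' ψ fun n n' ↦ BalancedTensor.hom_ext fun m y ↦ by
        rw [AddMonoidHom.add_apply, hψ, hψ, hψ, map_add, AddMonoidHom.add_apply,
          BalancedTensor.add_tmul])
      fun n a t ↦ by
        change ψ (MulOpposite.op a • n) t = ψ n (a • t)
        induction t using BalancedTensor.induction with
        | zero => rw [smul_zero, map_zero, map_zero]
        | tmul m y => rw [hψ, BalancedTensor.smul_tmul, hψ, mk_op_smul]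
        | add s t hs ht => rw [map_add, smul_add, map_add, hs, ht]
  have hG (n : N) (t : BalancedTensor S M Y) : G (BalancedTensor.tmul A n t) = ψ n t := rfl
  have hGF : Function.LeftInverse G F := fun t ↦ by
    induction t using BalancedTensor.induction with
    | zero => rw [map_zero, map_zero]
    | add s t hs ht => rw [map_add, map_add, hs, ht]
    | tmul e y =>
      induction e using BimoduleTensor.induction with
      | zero => rw [BalancedTensor.zero_tmul, map_zero, map_zero]
      | tmul n m => rw [hF, hG, hψ]
      | add a b ha hb => rw [BalancedTensor.add_tmul, map_add, map_add, ha, hb]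
  have hFG : Function.RightInverse G F := fun t ↦ by
    induction t using BalancedTensor.induction with
    | zero => rw [map_zero, map_zero]
    | add s t hs ht => rw [map_add, map_add, hs, ht]
    | tmul n t =>
      induction t using BalancedTensor.induction with
      | zero => rw [BalancedTensor.tmul_zero, map_zero, map_zero]
      | tmul m y => rw [hG, hψ, hF]
      | add a b ha hb => rw [BalancedTensor.tmul_add, map_add, map_add, ha, hb]
  exact ⟨.ofBijective F ⟨hGF.injective, hFG.surjective⟩⟩

end BimoduleTensor

end Associativity

/-! ### Resolutions by modules in `add(U)` -/

section InAdd

variable {R : Type*} [Ring R] {U U' V V' : Type*} [AddCommGroup U] [Module R U]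
  [AddCommGroup U'] [Module R U'] [AddCommGroup V] [Module R V] [AddCommGroup V'] [Module R V']

theorem InAdd.of_finite {ι : Type*} [Finite ι] (i : V →ₗ[R] (ι → U)) (p : (ι → U) →ₗ[R] V)
    (h : p ∘ₗ i = LinearMap.id) : InAdd R U V := by
  obtain ⟨n, ⟨e⟩⟩ := Finite.exists_equiv_fin ι
  let e' : (Fin n → U) ≃ₗ[R] (ι → U) := LinearEquiv.funCongrLeft R U e
  refine ⟨n, e'.symm.toLinearMap ∘ₗ i, p ∘ₗ e'.toLinearMap, ?_⟩
  ext x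
  simpa using LinearMap.congr_fun h x

theorem InAdd.of_retract (h : InAdd R U V) (i : V' →ₗ[R] V) (p : V →ₗ[R] V')
    (hp : p ∘ₗ i = LinearMap.id) : InAdd R U V' := by
  obtain ⟨r, j, q, hq⟩ := h
  refine ⟨r, j ∘ₗ i, p ∘ₗ q, LinearMap.ext fun x ↦ ?_⟩
  have := LinearMap.congr_fun hq (i x)
  simp only [LinearMap.comp_apply, LinearMap.id_apply] at this ⊢
  rw [this]
  exact LinearMap.congr_fun hp x

theorem InAdd.congr_right (h : InAdd R U V) (e : V ≃ₗ[R] V') : InAdd R U V' :=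
  h.of_retract e.symm.toLinearMap e.toLinearMap e.comp_symm

theorem InAdd.congr_left (h : InAdd R U V) (e : U ≃ₗ[R] U') : InAdd R U' V := by
  obtain ⟨r, i, p, h⟩ := h
  let e' : (Fin r → U) ≃ₗ[R] (Fin r → U') := LinearEquiv.piCongrRight fun _ ↦ e
  refine ⟨r, e'.toLinearMap ∘ₗ i, p ∘ₗ e'.symm.toLinearMap, LinearMap.ext fun x ↦ ?_⟩
  simpa using LinearMap.congr_fun h x

theorem InAdd.finite [Module.Finite R U] (h : InAdd R U V) : Module.Finite R V := by
  obtain ⟨r, i, p, h⟩ := h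
  exact .of_surjective p fun x ↦ ⟨i x, LinearMap.congr_fun h x⟩

/-- The summand sits in `r + s` copies of `U × R`: the first `r` supply `U`, the other `s` supply
`R`. -/
theorem InAdd.prod_free (h : InAdd R U V) (s : ℕ) : InAdd R (U × R) (V × (Fin s → R)) := by
  obtain ⟨r, i, p, h⟩ := h
  refine .of_finite (ι := Fin r ⊕ Fin s)
    (LinearMap.pi (Sum.elim
      (fun j ↦ LinearMap.inl R U R ∘ₗ LinearMap.proj j ∘ₗ i ∘ₗ LinearMap.fst R V (Fin s → R))
      fun j ↦ LinearMap.inr R U R ∘ₗ LinearMap.proj j ∘ₗ LinearMap.snd R V (Fin s → R)))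
    ((p ∘ₗ LinearMap.pi fun j ↦ LinearMap.fst R U R ∘ₗ LinearMap.proj (Sum.inl j)).prod
      (LinearMap.pi fun j ↦ LinearMap.snd R U R ∘ₗ LinearMap.proj (Sum.inr j)))
    (LinearMap.ext fun x ↦ Prod.ext ?_ ?_)
  · exact LinearMap.congr_fun h x.1
  · rfl

theorem InAdd.prod_left (h : InAdd R U V) : InAdd R (U × R) V :=
  (h.prod_free 0).of_retract (LinearMap.inl R V (Fin 0 → R)) (LinearMap.fst R V (Fin 0 → R)) rfl

theorem InAdd.lTensor {C S E U V : Type*} [Ring C] [Ring S] [AddCommGroup E] [Module Sᵐᵒᵖ E]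
    [Module C E] [SMulCommClass C Sᵐᵒᵖ E] [AddCommGroup U] [Module S U] [AddCommGroup V]
    [Module S V] (h : InAdd S U V) : InAdd C (BalancedTensor S E U) (BalancedTensor S E V) := by
  obtain ⟨r, i, p, h⟩ := h
  refine ⟨r, LinearMap.pi fun j ↦ BalancedTensor.lTensor C E (LinearMap.proj j ∘ₗ i),
    LinearMap.lsum C (fun _ : Fin r ↦ BalancedTensor S E U) ℕ
      fun j ↦ BalancedTensor.lTensor C E (p ∘ₗ LinearMap.single S (fun _ ↦ U) j),
    BalancedTensor.linearMap_ext fun e y ↦ ?_⟩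
  simp only [LinearMap.comp_apply, LinearMap.lsum_apply, LinearMap.sum_apply, LinearMap.pi_apply,
    LinearMap.proj_apply, BalancedTensor.lTensor_tmul, LinearMap.id_apply, LinearMap.single_apply]
  simp only [← BalancedTensor.mk_apply]
  rw [← map_sum, ← map_sum, Finset.univ_sum_single]
  exact congrArg _ (LinearMap.congr_fun h y)

end InAdd

section Resolution

universe w

variable {R : Type u} [Ring R] {U U' Z : Type*} [AddCommGroup U] [Module R U]
  [AddCommGroup U'] [Module R U'] [AddCommGroup Z] [Module R Z] {m : ℕ}

theorem HasAddResolution.congr_left (h : HasAddResolution R U m Z) (e : U ≃ₗ[R] U') :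
    HasAddResolution R U' m Z := by
  obtain ⟨V, d, ε, h₁, h₂⟩ := h
  exact ⟨V, d, ε, fun i hi ↦ (h₁ i hi).congr_left e, h₂⟩

/-- A resolution by modules in an arbitrary universe can be moved to the universe of the ring. -/
theorem HasAddResolution.of_universe [Module.Finite R U] (V : ℕ → Type w)
    [∀ i, AddCommGroup (V i)] [∀ i, Module R (V i)] (d : ∀ i, V (i + 1) →ₗ[R] V i)
    (ε : V 0 →ₗ[R] Z) (hV : ∀ i ≤ m, InAdd R U (V i)) (hV' : ∀ i, m < i → Subsingleton (V i))
    (hε : Function.Surjective ε) (hd : Function.Exact (d 0) ε)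
    (hd' : ∀ i, Function.Exact (d (i + 1)) (d i)) : HasAddResolution R U m Z := by
  -- The terms up to `m` are finitely generated over `R` and the later ones are zero, so all of them
  -- are small.
  have hsmall (i : ℕ) : Small.{u} (V i) := by
    rcases le_or_gt i m with hi | hi
    · have := (hV i hi).finite
      exact Module.Finite.small.{u} R (V i)
    · have := hV' i hi
      infer_instance
  let e (i : ℕ) : Shrink.{u} (V i) ≃ₗ[R] V i := Shrink.linearEquiv R (V i)
  refine ⟨fun i ↦ ModuleCat.of R (Shrink.{u} (V i)),
    fun i ↦ (e i).symm.toLinearMap ∘ₗ d i ∘ₗ (e (i + 1)).toLinearMap, ε ∘ₗ (e 0).toLinearMap,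
    fun i hi ↦ (hV i hi).congr_right (e i).symm,
    fun i hi ↦ (e i).toEquiv.subsingleton_congr.2 (hV' i hi), hε.comp (e 0).surjective,
    fun x ↦ ?_, fun i x ↦ ?_⟩
  · refine (hd (e 0 x)).trans ⟨fun ⟨y, hy⟩ ↦ ⟨(e 1).symm y, ?_⟩, fun ⟨y, hy⟩ ↦ ⟨e 1 y, ?_⟩⟩
    · simp [hy]
    · simp [← hy]
  · change (e i).symm (d i (e (i + 1) x)) = 0 ↔ _
    rw [LinearEquiv.map_eq_zero_iff]
    refine (hd' i (e (i + 1) x)).trans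
      ⟨fun ⟨y, hy⟩ ↦ ⟨(e (i + 2)).symm y, ?_⟩, fun ⟨y, hy⟩ ↦ ⟨e (i + 2) y, ?_⟩⟩
    · simp [hy]
    · simp [← hy]

/-- Right projectivity of `E` gives exactness; left finiteness of `E` makes `E ⊗_R U` finite, as the
change of universe requires. -/
theorem HasAddResolution.lTensor {C : Type*} [Ring C] {E : Type*} [AddCommGroup E]
    [Module Rᵐᵒᵖ E] [Module C E] [SMulCommClass C Rᵐᵒᵖ E] [Module.Finite C E]
    [Module.Finite Rᵐᵒᵖ E] [Module.Projective Rᵐᵒᵖ E] [Module.Finite R U]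
    (h : HasAddResolution R U m Z) :
    HasAddResolution C (BalancedTensor R E U) m (BalancedTensor R E Z) := by
  obtain ⟨V, d, ε, hV, hV', hε, hd, hd'⟩ := h
  refine .of_universe (fun i ↦ BalancedTensor R E (V i))
    (fun i ↦ BalancedTensor.lTensor C E (d i)) (BalancedTensor.lTensor C E ε)
    (fun i hi ↦ (hV i hi).lTensor) (fun i hi ↦ ⟨fun s t ↦ ?_⟩)
    (BalancedTensor.lTensor_surjective hε) (BalancedTensor.lTensor_exact hd)
    fun i ↦ BalancedTensor.lTensor_exact (hd' i)
  have := hV' i hi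
  have h0 (t : BalancedTensor R E (V i)) : t = 0 := by
    induction t using BalancedTensor.induction with
    | zero => rfl
    | tmul e y => rw [Subsingleton.elim y 0, BalancedTensor.tmul_zero]
    | add s t hs ht => rw [hs, ht, add_zero]
  rw [h0 s, h0 t]

/-- A resolution of `W` by modules in `add(U)` gives a resolution of the same length, by modules in
`add(U ⊕ R)`, of every module that is stably isomorphic to `W`. -/
theorem HasAddResolution.of_stableIso {W : Type*} [AddCommGroup W] [Module R W]
    (h : HasAddResolution R U m W) (hZ : StableIso R Z W) : HasAddResolution R (U × R) m Z := by
  obtain ⟨V, d, ε, hV, hV', hε, hd, hd'⟩ := h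
  obtain ⟨r, i, p, hpi, s, α, β, hαβ⟩ := hZ.exists_retract
  have hpi' (z : Z) : p (i z) = z := LinearMap.congr_fun hpi z
  -- The idempotent `c` projects onto the complement of `i(Z)` in `W ⊕ Rʳ`, and it factors as `β α`
  -- through `Rˢ`.
  let c : W × (Fin r → R) →ₗ[R] W × (Fin r → R) := LinearMap.id - i ∘ₗ p
  have hc (x) : c x = x - i (p x) := rfl
  have hcc (x) : c (c x) = c x := by simp [hc, hpi']
  have hβα (x) : β (α x) = c x := (LinearMap.congr_fun hαβ x).symm
  let e : V 0 × (Fin r → R) →ₗ[R] W × (Fin r → R) := ε.prodMap LinearMap.id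
  have he : Function.Surjective e := hε.prodMap Function.surjective_id
  obtain ⟨γ, hγ⟩ := Module.projective_lifting_property e (c ∘ₗ β) he
  have hγ' (x) : e (γ x) = c (β x) := LinearMap.congr_fun hγ x
  -- This is the preimage of `i(Z) = ker c` under `e`. It replaces `V 0`, and `1 - γ α c e` retracts
  -- `V 0 ⊕ Rʳ` onto it, because `γ` lifts `c β` through `e`.
  let V₀ : Submodule R (V 0 × (Fin r → R)) := LinearMap.ker (c ∘ₗ e)
  have hmem (x) : x ∈ V₀ ↔ c (e x) = 0 := Iff.rfl
  let π : V 0 × (Fin r → R) →ₗ[R] V₀ :=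
    (LinearMap.id - γ ∘ₗ α ∘ₗ c ∘ₗ e : V 0 × (Fin r → R) →ₗ[R] V 0 × (Fin r → R)).codRestrict V₀
      fun x ↦ by
        rw [hmem]
        change c (e (x - γ (α (c (e x))))) = 0
        rw [map_sub, map_sub, hγ', hβα, hcc, hcc, hcc, sub_self]
  have hπ : π ∘ₗ V₀.subtype = LinearMap.id := by
    ext1 x
    ext1
    change (x : V 0 × (Fin r → R)) - γ (α (c (e x))) = x
    rw [(hmem _).1 x.2, map_zero, map_zero, sub_zero]
  -- On `V₀` the map to `Z` has the same kernel as `e`, which is the kernel of `ε`; the resolution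
  -- from `V 1` on is therefore unchanged.
  have hker (x : V₀) (hx : p (e x) = 0) : e x = 0 := by
    have := (hmem _).1 x.2
    rwa [hc, hx, map_zero, sub_zero] at this
  let d₀ : V 1 →ₗ[R] V₀ := (LinearMap.inl R (V 0) (Fin r → R) ∘ₗ d 0).codRestrict V₀ fun x ↦ by
    rw [hmem]
    have : e ((LinearMap.inl R (V 0) (Fin r → R) ∘ₗ d 0) x) = 0 :=
      Prod.ext (hd.apply_apply_eq_zero x) rfl
    rw [this, map_zero]
  have hd₀ (x : V 1) : ((d₀ x : V₀) : V 0 × (Fin r → R)) = (d 0 x, 0) := rfl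
  let V' : ℕ → ModuleCat.{u} R
    | 0 => ModuleCat.of R V₀
    | i + 1 => V (i + 1)
  let d' : ∀ i, V' (i + 1) →ₗ[R] V' i
    | 0 => d₀
    | i + 1 => d (i + 1)
  refine ⟨V', d', p ∘ₗ e ∘ₗ V₀.subtype, ?_, ?_, fun z ↦ ?_, fun x ↦ ⟨fun hx ↦ ?_, ?_⟩, ?_⟩
  · rintro (_ | j) hj
    · exact ((hV 0 hj).prod_free r).of_retract V₀.subtype π hπ
    · exact (hV (j + 1) hj).prod_left
  · rintro (_ | j) hj
    · exact absurd hj (Nat.not_lt_zero m)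
    · exact hV' (j + 1) hj
  · obtain ⟨x, hx⟩ := he (i z)
    refine ⟨⟨x, (hmem x).2 ?_⟩, ?_⟩
    · rw [hx, hc, hpi', sub_self]
    · change p (e x) = z
      rw [hx, hpi']
  · have h0 := hker x hx
    obtain ⟨y, hy⟩ := (hd _).1 (congrArg Prod.fst h0)
    refine ⟨y, Subtype.ext ?_⟩
    exact Prod.ext hy (congrArg Prod.snd h0).symm
  · rintro ⟨y, rfl⟩
    change p (e (d 0 y, 0)) = 0
    have : e (d 0 y, 0) = 0 := Prod.ext (hd.apply_apply_eq_zero y) rfl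
    rw [this, map_zero]
  · rintro (_ | j) x
    · refine Iff.trans ?_ (hd' 0 x)
      change d₀ x = 0 ↔ d 0 x = 0
      rw [Subtype.ext_iff, hd₀]
      simp
    · exact hd' (j + 1) x

end Resolution

/-! ### Invariance of the Igusa-Todorov distance -/

section Invariance

variable {k A B M N : Type*} [Field k]
    [Ring A] [Algebra k A] [Ring B] [Algebra k B]
    [AddCommGroup M] [Module k M] [Module A M] [Module Bᵐᵒᵖ M]
    [IsScalarTower k A M] [IsScalarTower k Bᵐᵒᵖ M] [SMulCommClass A Bᵐᵒᵖ M]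
    [AddCommGroup N] [Module k N] [Module B N] [Module Aᵐᵒᵖ N]
    [IsScalarTower k B N] [IsScalarTower k Aᵐᵒᵖ N] [SMulCommClass B Aᵐᵒᵖ N] {l : ℕ}

theorem IsSingularEquivOfMoritaTypeWithLevel.symm
    (h : IsSingularEquivOfMoritaTypeWithLevel k A B M N l) :
    IsSingularEquivOfMoritaTypeWithLevel k B A N M l where
  finite_left_M := h.finite_left_N
  projective_left_M := h.projective_left_N
  finite_right_M := h.finite_right_N
  projective_right_M := h.projective_right_N
  finite_left_N := h.finite_left_M
  projective_left_N := h.projective_left_M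
  finite_right_N := h.finite_right_M
  projective_right_N := h.projective_right_M
  tensor_MN := h.tensor_NM
  tensor_NM := h.tensor_MN

attribute [local instance] TensorProduct.Algebra.module

/-- Tensoring the stable isomorphism between `N ⊗_A M` and `Ωˡ(B)` with `Y` gives the claim, since
`B` is right projective and `B ⊗_B Y ≃ Y`. -/
theorem IsSingularEquivOfMoritaTypeWithLevel.stableIso_tensor [Module.Finite k B]
    (h : IsSingularEquivOfMoritaTypeWithLevel k A B M N l) {Y : Type*} [AddCommGroup Y]
    [Module B Y] [Module.Finite B Y] {W : ModuleCat B} (hW : IsSyzygy B Y l W) :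
    StableIso B (BalancedTensor A N (BalancedTensor B M Y)) W := by
  have := IsNoetherianRing.of_finite k B
  have := IsNoetherianRing.of_finite k (B ⊗[k] Bᵐᵒᵖ)
  let _ : Module k Y := Module.compHom Y (algebraMap k B)
  have : IsScalarTower k B Y := .of_algebraMap_smul fun _ _ ↦ rfl
  have : Module.Finite k Y := .trans B Y
  obtain ⟨E, hE, hst⟩ := h.tensor_NM
  obtain ⟨e⟩ := BimoduleTensor.nonempty_assoc k B A B N M Y
  exact (StableIso.of_equiv e.symm).trans ((hst.stableIso.tensorHom Y).trans
    (hE.stableIso_tensor hW (.of_equiv (AsBimodule.regularTensorEquiv k B Y))).2)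

variable [Module.Finite k A] [Module.Finite k B]

theorem IsSingularEquivOfMoritaTypeWithLevel.isIgusaTodorov
    (h : IsSingularEquivOfMoritaTypeWithLevel k A B M N l) {m n : ℕ} (hA : IsIgusaTodorov A m n) :
    IsIgusaTodorov B m (l + n) := by
  have := IsArtinianRing.of_finite k A
  have := IsArtinianRing.of_finite k B
  have := h.finite_left_M
  have := h.finite_left_N
  have := h.projective_left_N
  have := h.finite_right_N
  have := h.projective_right_N
  obtain ⟨U, _, hU⟩ := hA
  have := Module.Finite.small B (BalancedTensor A N U)
  let eU := Shrink.linearEquiv B (BalancedTensor A N U)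
  have := Module.Finite.equiv eU.symm
  -- The extra summand `B` absorbs the projectives by which stably isomorphic modules differ;
  -- `Shrink` only moves `N ⊗_A U` to the universe of `B`.
  refine ⟨ModuleCat.of B (Shrink (BalancedTensor A N U) × B), ?_, fun Y _ ↦ ?_⟩
  · exact inferInstanceAs (Module.Finite B (Shrink (BalancedTensor A N U) × B))
  have := Module.Finite.small A (BalancedTensor B M Y)
  let e := Shrink.linearEquiv A (BalancedTensor B M Y)
  have hX := Module.Finite.equiv e.symm
  obtain ⟨W, hW⟩ := exists_isSyzygy (R := B) (X := Y) l
  have := hW.finite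
  -- The syzygy `Ωˡ⁺ⁿ(Y)` is taken as `Ωⁿ(Ωˡ(Y))`: the first `l` steps match `N ⊗_A M ⊗_B Y`, the
  -- last `n` match the syzygies over `A`.
  obtain ⟨Z, hZ⟩ := exists_isSyzygy (R := B) (X := W) n
  obtain ⟨Z₀, hZ₀, hres⟩ := hU (ModuleCat.of A (Shrink (BalancedTensor B M Y))) hX
  refine ⟨Z, hW.comp hZ, ?_⟩
  have hst := hZ₀.stableIso_balancedTensor (E := N) hZ
    ((StableIso.of_equiv (BalancedTensor.lCongr B N e)).trans (h.stableIso_tensor hW))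
  exact (hres.lTensor.of_stableIso hst.symm).congr_left (eU.symm.prodCongr (.refl B B))

theorem IsSingularEquivOfMoritaTypeWithLevel.itdist_le
    (h : IsSingularEquivOfMoritaTypeWithLevel k A B M N l) : ITdist B ≤ ITdist A :=
  le_iInf₂ fun m ⟨n, hA⟩ ↦ iInf₂_le m ⟨l + n, h.isIgusaTodorov hA⟩

end Invariance

theorem theorem1p4 (k A B M N : Type*) [Field k]
    [Ring A] [Algebra k A] [Module.Finite k A]
    [Ring B] [Algebra k B] [Module.Finite k B]
    [AddCommGroup M] [Module k M] [Module A M] [Module Bᵐᵒᵖ M]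
    [IsScalarTower k A M] [IsScalarTower k Bᵐᵒᵖ M] [SMulCommClass A Bᵐᵒᵖ M]
    [AddCommGroup N] [Module k N] [Module B N] [Module Aᵐᵒᵖ N]
    [IsScalarTower k B N] [IsScalarTower k Aᵐᵒᵖ N] [SMulCommClass B Aᵐᵒᵖ N]
    (l : ℕ) (h : IsSingularEquivOfMoritaTypeWithLevel k A B M N l) :
    ITdist A = ITdist B :=
  le_antisymm h.symm.itdist_le h.itdist_le
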